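/- Let $\Pi$ be an irreducible reduced crystallographic root system spanning a finite-dimensional real Euclidean space $V$ with scalar product $\langle\,,\rangle$, and let $\Delta=\{\alpha_1,\dots,\alpha_n\}$ be a set of simple roots. Put $\alpha^\vee=2\alpha/\langle\alpha,\alpha\rangle$ and let $W$ be the Weyl group, generated by the reflections $r_{\alpha_i}a=a-\langle\alpha_i,a\rangle\alpha_i^\vee$. Let $Q$ and $Q^\vee$ be the lattices spanned over $\mathbb Z$ by the roots and by the coroots, $P^\vee=\{x:\langle x,\alpha\rangle\in\mathbb Z\ \forall\alpha\in\Delta\}$ and $P=\{x:\langle x,\alpha^\vee\rangle\in\mathbb Z\ \forall\alpha\in\Delta\}$, with bases $\omega_j^\vee$, $\omega_j$ given by $\langle\alpha_i,\omega_j^\vee\rangle=\delta_{ij}=\langle\alpha_i^\vee,\omega_j\rangle$. Let $\xi=\sum m_i\alpha_i$ be the highest root and $\eta=\sum m_i^\vee\alpha_i^\vee$ the highest root of the dual root system $\Pi^\vee$. Let $W^{\mathrm{aff}}=T(Q^\vee)\rtimes W$ and $\widehat W^{\mathrm{aff}}=T(Q)\rtimes W$ be the affine and the dual affine Weyl group acting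 on $V$, where $T(L)$ denotes the translations by $L$, and put $$F=\Big\{\sum_{i=1}^n y_i\omega_i^\vee: y_0,\dots,y_n\ge 0,\ y_0+\sum_{i=1}^n y_im_i=1\Big\},\qquad F^\vee=\Big\{\sum_{i=1}^n z_i\omega_i: z_0,\dots,z_n\ge 0,\ z_0+\sum_{i=1}^n z_im_i^\vee=1\Big\}.$$ A vector $\rho^\vee\in V$ is an admissible shift if $W(\rho^\vee+P^\vee)=\rho^\vee+P^\vee$, and $\rho\in V$ is an admissible dual shift if $W(\rho+P)=\rho+P$. A sign homomorphism is a group homomorphism $\sigma:W\to\{\pm1\}$. For such $\rho,\rho^\vee,\sigma$ put $\gamma^\sigma_\rho(g)=e^{2\pi i\langle q^\vee,\rho\rangle}\sigma(w)$ for $g=T(q^\vee)w\in W^{\mathrm{aff}}$, and $\widehat\gamma^\sigma_{\rho^\vee}(g)=e^{2\pi i\langle q,\rho^\vee\rangle}\sigma(w)$ for $g=T(q)w\in\widehat W^{\mathrm{aff}}$. Define $$F^\sigma(\rho)=\{a\in F:\gamma^\sigma_\rho(\mathrm{Stab}_{W^{\mathrm{aff}}}(a))=\{1\}\},\qquad F^{\sigma\vee}(\rho^\vee)=\{a\in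 F^\vee:\widehat\gamma^\sigma_{\rho^\vee}(\mathrm{Stab}_{\widehat W^{\mathrm{aff}}}(a))=\{1\}\},$$ and, for a positive integer $M$, $$F^\sigma_M(\rho,\rho^\vee)=\tfrac1M(\rho^\vee+P^\vee)\cap F^\sigma(\rho),\qquad \Lambda^\sigma_M(\rho,\rho^\vee)=(\rho+P)\cap M F^{\sigma\vee}(\rho^\vee).$$ Theorem. For every such root system, every admissible shift $\rho^\vee$, every admissible dual shift $\rho$, every sign homomorphism $\sigma$ and every positive integer $M$, the label set $\Lambda^\sigma_M(\rho,\rho^\vee)$ and the grid $F^\sigma_M(\rho,\rho^\vee)$ are finite and have the same number of elements: $$|\Lambda^\sigma_M(\rho,\rho^\vee)|=|F^\sigma_M(\rho,\rho^\vee)|.$$ -/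

import Mathlib

open scoped RealInnerProductSpace

namespace OrbitGrid

section HighestRoot

variable {ι M N : Type*} [AddCommGroup M] [Module ℝ M] [AddCommGroup N] [Module ℝ N]
  {P : RootPairing ι ℝ M N}

/-- The partial ordering `ν ≤ μ` determined by the simple roots. -/
def RootLE (b : P.Base) (ν μ : M) : Prop :=
  ∃ k : b.support → ℝ, (∀ j, 0 ≤ k j) ∧ μ - ν = ∑ j, k j • P.root j

theorem rootLE_iff [P.IsRootSystem] (b : P.Base) (ν μ : M) :
    RootLE b ν μ ↔ ∀ j, b.toWeightBasis.repr ν j ≤ b.toWeightBasis.repr μ j := by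
  constructor
  · rintro ⟨k, hk, h⟩ j
    have h1 : b.toWeightBasis.repr (μ - ν) j = k j := by
      have h2 : μ - ν = ∑ j, k j • b.toWeightBasis j := by simpa using h
      rw [h2, b.toWeightBasis.repr_sum_self]
    rw [map_sub, Finsupp.sub_apply] at h1
    linarith [hk j]
  · intro h
    refine ⟨fun j => b.toWeightBasis.repr (μ - ν) j, fun j => ?_, ?_⟩
    · simpa using h j
    · conv_lhs => rw [← b.toWeightBasis.sum_repr (μ - ν)]
      simp

theorem repr_sign [P.IsRootSystem] (b : P.Base) (i : ι) :
    (∀ j, 0 ≤ b.toWeightBasis.repr (P.root i) j) ∨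
      (∀ j, b.toWeightBasis.repr (P.root i) j ≤ 0) := by
  have key : ∀ x ∈ AddSubmonoid.closure (P.root '' b.support),
      ∀ j, 0 ≤ b.toWeightBasis.repr x j := by
    classical
    intro x hx j
    induction hx using AddSubmonoid.closure_induction with
    | mem x hx =>
      obtain ⟨i, hi, rfl⟩ := hx
      rw [b.toWeightBasis_repr_root ⟨i, hi⟩, Finsupp.single_apply]
      split_ifs <;> norm_num
    | zero => simp
    | add x y _ _ hx hy => simpa using add_nonneg hx hy
  rcases b.root_mem_or_neg_mem i with h | h
  · exact Or.inl (key _ h)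
  · right
    intro j
    have := key _ h j
    simp only [map_neg, Finsupp.neg_apply] at this
    linarith

theorem root_eq_of_repr [P.IsRootSystem] (b : P.Base) {i j : ι}
    (h : ∀ k, b.toWeightBasis.repr (P.root i) k = b.toWeightBasis.repr (P.root j) k) : i = j :=
  P.root.injective (b.toWeightBasis.repr.injective (Finsupp.ext h))

/-- `l` is a maximal root. -/
def IsMaxRoot (b : P.Base) (l : ι) : Prop := ∀ m, RootLE b (P.root l) (P.root m) → m = l

theorem exists_isMaxRoot [Finite ι] [P.IsRootSystem] (b : P.Base) (k : ι) :
    ∃ l, RootLE b (P.root k) (P.root l) ∧ IsMaxRoot b l := by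
  let H : ι → ℝ := fun i => ∑ j, b.toWeightBasis.repr (P.root i) j
  obtain ⟨l, hl, hmax⟩ := Set.exists_max_image {l | RootLE b (P.root k) (P.root l)} H
    (Set.toFinite _) ⟨k, (rootLE_iff b _ _).2 fun _ => le_rfl⟩
  refine ⟨l, hl, fun m hm => ?_⟩
  have hkm : RootLE b (P.root k) (P.root m) :=
    (rootLE_iff b _ _).2 fun j => ((rootLE_iff b _ _).1 hl j).trans ((rootLE_iff b _ _).1 hm j)
  have h1 := hmax m hkm
  have h2 := (rootLE_iff b _ _).1 hm
  have h3 := (Finset.sum_eq_sum_iff_of_le (fun j _ => h2 j)).1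
    (le_antisymm (Finset.sum_le_sum fun j _ => h2 j) h1)
  exact root_eq_of_repr b fun j => (h3 j (Finset.mem_univ j)).symm

theorem pairingIn_eq_sum [P.IsRootSystem] [P.IsCrystallographic] (b : P.Base) (l m : ι) : (P.pairingIn ℤ l m : ℝ) =
    ∑ k : b.support, b.toWeightBasis.repr (P.root l) k * (P.pairingIn ℤ k m : ℝ) := by
  have h : ∀ a c : ι, (P.pairingIn ℤ a c : ℝ) = P.toLinearMap (P.root a) (P.coroot c) := by
    intro a c
    have := P.algebraMap_pairingIn ℤ a c
    simpa using this
  simp_rw [h]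
  conv_lhs => rw [← b.toWeightBasis.sum_repr (P.root l)]
  simp [map_sum]

section

variable [Finite ι] [P.IsRootSystem] [P.IsCrystallographic] {b : P.Base} {l : ι}

theorem IsMaxRoot.nonneg (hl : IsMaxRoot b l) (j : b.support) :
    0 ≤ b.toWeightBasis.repr (P.root l) j := by
  classical
  rcases repr_sign b l with h | h
  · exact h j
  · have : (j : ι) = l := by
      refine hl j ((rootLE_iff b _ _).2 fun i => (h i).trans ?_)
      rw [b.toWeightBasis_repr_root, Finsupp.single_apply]
      split_ifs <;> norm_num
    rw [← this, b.toWeightBasis_repr_root, Finsupp.single_apply]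
    split_ifs <;> norm_num

theorem IsMaxRoot.pairingIn_nonneg (hl : IsMaxRoot b l) (j : b.support) :
    0 ≤ P.pairingIn ℤ l j := by
  classical
  by_contra! h
  have hne : P.root l ≠ - P.root j := by
    intro h'
    have := hl.nonneg j
    rw [h', map_neg, b.toWeightBasis_repr_root] at this
    simp at this
    linarith
  obtain ⟨m, hm⟩ := P.root_add_root_mem_of_pairingIn_neg h hne
  have hml : m = l := by
    refine hl m ((rootLE_iff b _ _).2 fun i => ?_)
    rw [hm, map_add, b.toWeightBasis_repr_root, Finsupp.add_apply, Finsupp.single_apply]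
    split_ifs <;> norm_num
  rw [hml] at hm
  exact P.ne_zero j (by simpa using hm)

theorem IsMaxRoot.pos [P.IsReduced] [P.IsIrreducible] (hl : IsMaxRoot b l) (j : b.support) :
    0 < b.toWeightBasis.repr (P.root l) j := by
  obtain ⟨i, hi⟩ : ∃ i, 0 < b.toWeightBasis.repr (P.root l) i := by
    by_contra! h
    refine P.ne_zero l (b.toWeightBasis.repr.injective (Finsupp.ext fun i => ?_))
    simpa using le_antisymm (h i) (hl.nonneg i)
  refine b.induction_on_cartanMatrix (fun j => 0 < b.toWeightBasis.repr (P.root l) j) hi ?_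
  intro i j hi hij
  by_contra! hj
  have hj0 : b.toWeightBasis.repr (P.root l) j = 0 := le_antisymm hj (hl.nonneg j)
  have hne : i ≠ j := by rintro rfl; exact absurd hi (by rw [hj0]; simp)
  have hij' : b.cartanMatrix i j ≠ 0 := by
    rwa [ne_eq, b.cartanMatrix_apply_eq_zero_iff_symm]
  have h0 : (0 : ℝ) ≤ (P.pairingIn ℤ l j : ℝ) := by exact_mod_cast hl.pairingIn_nonneg j
  rw [pairingIn_eq_sum b] at h0
  refine absurd h0 (not_le.2 (Finset.sum_neg' (fun k _ => ?_) ⟨i, Finset.mem_univ i, ?_⟩))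
  · rcases eq_or_ne k j with rfl | hk
    · simp [hj0]
    · have : b.cartanMatrix k j ≤ 0 := b.cartanMatrix_le_zero_of_ne k j hk
      exact mul_nonpos_of_nonneg_of_nonpos (hl.nonneg k) (by exact_mod_cast this)
  · have : b.cartanMatrix i j < 0 := lt_of_le_of_ne (b.cartanMatrix_le_zero_of_ne i j hne) hij'
    exact mul_neg_of_pos_of_neg hi (by exact_mod_cast this)

theorem IsMaxRoot.unique [P.IsReduced] [P.IsIrreducible] {l' : ι} (hl : IsMaxRoot b l)
    (hl' : IsMaxRoot b l') : l = l' := by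
  by_contra hne
  have hnn : ∀ k : b.support, 0 ≤ P.pairingIn ℤ k l' := by
    intro k
    have h1 := hl'.pairingIn_nonneg k
    by_contra! h2
    rw [P.pairingIn_lt_zero_iff] at h2
    omega
  obtain ⟨k, hk, hk0⟩ := RootPairing.Base.exists_mem_support_pos_pairingIn_ne_zero (b := b) l'
  have hpos : (0 : ℝ) < (P.pairingIn ℤ l l' : ℝ) := by
    rw [pairingIn_eq_sum b]
    refine Finset.sum_pos' (fun k _ => mul_nonneg (hl.nonneg k) (by exact_mod_cast hnn k))
      ⟨⟨k, hk⟩, Finset.mem_univ _, mul_pos (hl.pos _) ?_⟩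
    exact_mod_cast lt_of_le_of_ne (hnn ⟨k, hk⟩) hk0.symm
  obtain ⟨m, hm⟩ := P.root_sub_root_mem_of_pairingIn_pos (by exact_mod_cast hpos) hne
  rcases repr_sign b m with h | h
  · refine hne (hl' l ((rootLE_iff b _ _).2 fun j => ?_))
    simpa [hm] using h j
  · refine hne (hl l' ((rootLE_iff b _ _).2 fun j => ?_)).symm
    simpa [hm] using h j

end

theorem exists_highestRoot [Finite ι] [P.IsRootSystem] [P.IsCrystallographic] [P.IsReduced]
    [P.IsIrreducible] (b : P.Base) : ∃ i, ∀ j, RootLE b (P.root j) (P.root i) := by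
  have : Nontrivial M := RootPairing.IsIrreducible.nontrivial P
  have : Nonempty ι := by
    by_contra h
    rw [not_nonempty_iff] at h
    have h1 := RootPairing.IsRootSystem.span_root_eq_top (P := P)
    rw [Set.range_eq_empty, Submodule.span_empty] at h1
    exact bot_ne_top h1
  obtain ⟨i, -, hi⟩ := exists_isMaxRoot b (Classical.arbitrary ι)
  refine ⟨i, fun j => ?_⟩
  obtain ⟨l, hjl, hl⟩ := exists_isMaxRoot b j
  rwa [hi.unique hl]

/-- The index of the highest root `ξ`, the greatest root for the partial ordering. -/
noncomputable def highestRoot [Finite ι] [P.IsRootSystem] [P.IsCrystallographic] [P.IsReduced]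
    [P.IsIrreducible] (b : P.Base) : ι :=
  (exists_highestRoot b).choose

theorem rootLE_highestRoot [Finite ι] [P.IsRootSystem] [P.IsCrystallographic] [P.IsReduced]
    [P.IsIrreducible] (b : P.Base) (j : ι) : RootLE b (P.root j) (P.root (highestRoot b)) :=
  (exists_highestRoot b).choose_spec j

end HighestRoot

/-! The next definitions are stated for the coweight side (`P^∨`, `ω^∨`, marks `m`, domain `F`).
Applied to `P.flip` and `b.flip`, where roots and coroots are interchanged, they give the weight
side (`P`, `ω`, dual marks `m^∨`, domain `F^∨`). -/

section Alcove

variable {ι M N : Type*} [AddCommGroup M] [Module ℝ M] [AddCommGroup N] [Module ℝ N]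
  {P : RootPairing ι ℝ M N}

/-- The mark `m_j`: the coefficient of `α_j` in the highest root. -/
noncomputable def mark [Finite ι] [P.IsRootSystem] [P.IsCrystallographic] [P.IsReduced]
    [P.IsIrreducible] (b : P.Base) (j : b.support) : ℝ :=
  b.toWeightBasis.repr (P.root (highestRoot b)) j

/-- The vectors `ω_j^∨` with `⟨α_i, ω_j^∨⟩ = δ_ij`. -/
noncomputable def fundamentalCoweight [P.IsRootSystem] (b : P.Base) (j : b.support) : N :=
  P.toLinearMap.flip.toPerfPair.symm (b.toWeightBasis.coord j)

theorem root_fundamentalCoweight [P.IsRootSystem] [DecidableEq ι] (b : P.Base)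
    (i j : b.support) :
    P.toLinearMap (P.root i) (fundamentalCoweight b j) = if i = j then 1 else 0 := by
  rw [fundamentalCoweight, LinearMap.apply_toPerfPair_flip, Module.Basis.coord_apply,
    b.toWeightBasis_repr_root, Finsupp.single_apply]

/-- The lattice `P^∨` of vectors pairing integrally with every simple root. -/
def coweightLattice (b : P.Base) : AddSubgroup N where
  carrier := {x | ∀ i ∈ b.support, ∃ k : ℤ, P.toLinearMap (P.root i) x = k}
  zero_mem' i _ := ⟨0, by simp⟩
  add_mem' hx hy i hi := by
    obtain ⟨k, hk⟩ := hx i hi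
    obtain ⟨l, hl⟩ := hy i hi
    exact ⟨k + l, by simp [hk, hl]⟩
  neg_mem' hx i hi := by
    obtain ⟨k, hk⟩ := hx i hi
    exact ⟨-k, by simp [hk]⟩

/-- The domain `F`: all `∑ y_j ω_j^∨` with `y_0, y_j ≥ 0` and `y_0 + ∑ y_j m_j = 1`. -/
def fundamentalDomain [Finite ι] [P.IsRootSystem] [P.IsCrystallographic] [P.IsReduced]
    [P.IsIrreducible] (b : P.Base) : Set N :=
  {a | ∃ (y₀ : ℝ) (y : b.support → ℝ), 0 ≤ y₀ ∧ (∀ j, 0 ≤ y j) ∧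
    y₀ + ∑ j, y j * mark b j = 1 ∧ a = ∑ j, y j • fundamentalCoweight b j}

end Alcove

/-- The root pairing `P` of `V` with itself is a root system of the Euclidean space `V` in the
classical sense: the pairing is the scalar product and `α^∨ = 2α/⟨α, α⟩`. -/
class IsEuclidean {ι V : Type*} [NormedAddCommGroup V] [InnerProductSpace ℝ V]
    (P : RootPairing ι ℝ V V) : Prop where
  toLinearMap_eq : ∀ x y, P.toLinearMap x y = ⟪x, y⟫
  coroot_eq : ∀ i, P.coroot i = (2 / ⟪P.root i, P.root i⟫) • P.root i

section Weyl

variable {ι V : Type*} [NormedAddCommGroup V] [InnerProductSpace ℝ V] {P : RootPairing ι ℝ V V}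

/-- The Weyl group `W`, generated by the reflections `r_α a = a - ⟨α, a⟩ α^∨` in the simple
roots. -/
def weylGroup (b : P.Base) : Subgroup (V ≃ₗ[ℝ] V) :=
  Subgroup.closure (P.coreflection '' b.support)

theorem coreflection_eq_reflection [IsEuclidean P] (i : ι) (x : V) :
    P.coreflection i x = P.reflection i x := by
  rw [P.coreflection_apply, P.reflection_apply]
  simp only [RootPairing.root', RootPairing.coroot', LinearMap.flip_apply,
    IsEuclidean.toLinearMap_eq]
  rw [IsEuclidean.coroot_eq i, inner_smul_right, smul_smul, real_inner_comm x, mul_comm]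

theorem weylGroup_induction (b : P.Base) (L : AddSubgroup V)
    (h : ∀ i, ∀ x ∈ L, P.coreflection i x ∈ L) :
    ∀ w ∈ weylGroup b, ∀ x ∈ L, w x ∈ L := by
  intro w hw
  induction hw using Subgroup.closure_induction'' with
  | mem w hw => obtain ⟨i, -, rfl⟩ := hw; exact h i
  | inv_mem w hw =>
    obtain ⟨i, -, rfl⟩ := hw
    rw [P.coreflection_inv]
    exact h i
  | one => intro x hx; simpa using hx
  | mul v w _ _ hv hw => intro x hx; exact hv _ (hw x hx)

theorem weylGroup_corootSpan (b : P.Base) :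
    ∀ w ∈ weylGroup b, ∀ x ∈ (P.corootSpan ℤ).toAddSubgroup,
      w x ∈ (P.corootSpan ℤ).toAddSubgroup := by
  refine weylGroup_induction b _ fun i x hx => ?_
  simp only [Submodule.mem_toAddSubgroup] at hx ⊢
  induction hx using Submodule.span_induction with
  | mem x hx =>
    obtain ⟨j, rfl⟩ := hx
    rw [← P.coroot_reflectionPerm]
    exact Submodule.subset_span ⟨_, rfl⟩
  | zero => simp
  | add x y _ _ hx hy => rw [map_add]; exact add_mem hx hy
  | smul k x _ hx => rw [map_zsmul]; exact Submodule.smul_mem _ k hx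

theorem weylGroup_rootSpan [IsEuclidean P] (b : P.Base) :
    ∀ w ∈ weylGroup b, ∀ x ∈ (P.rootSpan ℤ).toAddSubgroup,
      w x ∈ (P.rootSpan ℤ).toAddSubgroup := by
  refine weylGroup_induction b _ fun i x hx => ?_
  rw [coreflection_eq_reflection]
  simp only [Submodule.mem_toAddSubgroup] at hx ⊢
  induction hx using Submodule.span_induction with
  | mem x hx =>
    obtain ⟨j, rfl⟩ := hx
    rw [← P.root_reflectionPerm]
    exact Submodule.subset_span ⟨_, rfl⟩
  | zero => simp
  | add x y _ _ hx hy => rw [map_add]; exact add_mem hx hy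
  | smul k x _ hx => rw [map_zsmul]; exact Submodule.smul_mem _ k hx

/-- The group `T(L) ⋊ W` of all maps `a ↦ w a + q` with `w ∈ W` and `q ∈ L`, for a `W`-stable
lattice `L`. The retraction to `W` is `g ↦ g.linear` and the translation part is `g ↦ g 0`. -/
def affineGroup (W : Subgroup (V ≃ₗ[ℝ] V)) (L : AddSubgroup V)
    (hL : ∀ w ∈ W, ∀ x ∈ L, w x ∈ L) : Subgroup (V ≃ᵃ[ℝ] V) where
  carrier := {g | g.linear ∈ W ∧ g 0 ∈ L}
  one_mem' := ⟨W.one_mem, by simp⟩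
  mul_mem' {g h} hg hh := by
    refine ⟨W.mul_mem hg.1 hh.1, ?_⟩
    have h1 : (g * h) 0 = g.linear (h 0) + g 0 := by
      simpa using g.map_vadd 0 (h 0)
    rw [h1]
    exact L.add_mem (hL _ hg.1 _ hh.2) hg.2
  inv_mem' {g} hg := by
    refine ⟨W.inv_mem hg.1, ?_⟩
    have h1 : g⁻¹ 0 = -(g.linear⁻¹ (g 0)) := by
      rw [AffineEquiv.inv_def, AffineEquiv.symm_apply_eq]
      have := g.map_vadd 0 (-(g.linear⁻¹ (g 0)))
      have h2 : g.linear (g.linear⁻¹ (g 0)) = g 0 := g.linear.apply_symm_apply _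
      simp only [vadd_eq_add, add_zero, map_neg, h2, neg_add_cancel] at this
      exact this.symm
    rw [h1]
    exact L.neg_mem (hL _ (W.inv_mem hg.1) _ hg.2)

/-- The affine Weyl group `W^aff = T(Q^∨) ⋊ W`. -/
def affineWeylGroup (b : P.Base) : Subgroup (V ≃ᵃ[ℝ] V) :=
  affineGroup (weylGroup b) (P.corootSpan ℤ).toAddSubgroup (weylGroup_corootSpan b)

/-- The dual affine Weyl group `T(Q) ⋊ W`. -/
def dualAffineWeylGroup [IsEuclidean P] (b : P.Base) : Subgroup (V ≃ᵃ[ℝ] V) :=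
  affineGroup (weylGroup b) (P.rootSpan ℤ).toAddSubgroup (weylGroup_rootSpan b)

/-- The shifted lattice `ρ + L` satisfies `W(ρ + L) = ρ + L`. -/
def IsAdmissible (W : Subgroup (V ≃ₗ[ℝ] V)) (L : AddSubgroup V) (ρ : V) : Prop :=
  {y | ∃ w ∈ W, ∃ x ∈ L, y = w (ρ + x)} = {y | ∃ x ∈ L, y = ρ + x}

/-- `ρ^∨` is an admissible shift: `W(ρ^∨ + P^∨) = ρ^∨ + P^∨`. -/
def IsAdmissibleShift (b : P.Base) (ρv : V) : Prop :=
  IsAdmissible (weylGroup b) (coweightLattice b) ρv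

/-- `ρ` is an admissible dual shift: `W(ρ + P) = ρ + P`. -/
def IsAdmissibleDualShift (b : P.Base) (ρ : V) : Prop :=
  IsAdmissible (weylGroup b) (coweightLattice (P := P.flip) b.flip) ρ

/-- The number `γ(g) = e^{2πi⟨q, ρ⟩} σ(w)` for the affine map `g : a ↦ w a + q`, `w ∈ W`. -/
noncomputable def gamma {W : Subgroup (V ≃ₗ[ℝ] V)} (σ : W →* ℤˣ) (ρ : V) (g : V ≃ᵃ[ℝ] V)
    (hg : g.linear ∈ W) : ℂ :=
  Complex.exp (2 * Real.pi * Complex.I * (⟪g 0, ρ⟫ : ℝ)) * ((σ ⟨g.linear, hg⟩ : ℤ) : ℂ)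

variable [Finite ι] [P.IsRootSystem] [P.IsCrystallographic] [P.IsReduced] [P.IsIrreducible]

/-- The set `F^σ(ρ)` of the points of `F` on whose `W^aff`-stabilizer `γ^σ_ρ` is trivial. -/
def signDomain (b : P.Base) (σ : weylGroup b →* ℤˣ) (ρ : V) : Set V :=
  {a | a ∈ fundamentalDomain b ∧
    ∀ (g : V ≃ᵃ[ℝ] V) (hg : g ∈ affineWeylGroup b), g a = a → gamma σ ρ g hg.1 = 1}

/-- The set `F^{σ∨}(ρ^∨)` of the points of `F^∨` on whose stabilizer in the dual affine Weyl group
the dual `γ`-homomorphism is trivial. -/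
def dualSignDomain [IsEuclidean P] (b : P.Base) (σ : weylGroup b →* ℤˣ) (ρv : V) : Set V :=
  {a | a ∈ fundamentalDomain (P := P.flip) b.flip ∧
    ∀ (g : V ≃ᵃ[ℝ] V) (hg : g ∈ dualAffineWeylGroup b), g a = a → gamma σ ρv g hg.1 = 1}

/-- The grid `F^σ_M(ρ, ρ^∨) = (1/M)(ρ^∨ + P^∨) ∩ F^σ(ρ)`. -/
def grid (b : P.Base) (σ : weylGroup b →* ℤˣ) (M : ℕ) (ρ ρv : V) : Set V :=
  {a | ∃ x ∈ coweightLattice b, a = (1 / (M : ℝ)) • (ρv + x)} ∩ signDomain b σ ρ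

/-- The label set `Λ^σ_M(ρ, ρ^∨) = (ρ + P) ∩ M F^{σ∨}(ρ^∨)`. -/
def labels [IsEuclidean P] (b : P.Base) (σ : weylGroup b →* ℤˣ) (M : ℕ) (ρ ρv : V) : Set V :=
  {c | ∃ x ∈ coweightLattice (P := P.flip) b.flip, c = ρ + x} ∩
    {c | ∃ z ∈ dualSignDomain b σ ρv, c = (M : ℝ) • z}

end Weyl

end OrbitGrid

set_option linter.unusedSectionVars false

/-! Both cardinalities are dimensions of function spaces, and a discrete Fourier transform compares
them. Take the functions on `(1/M)(ρ^∨ + P^∨)` with `f (g a) = γ(g) f a` for `g` in the affine Weyl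
group. Each orbit meets the alcove `F` exactly once, so `f` is determined by its values on `F`. At a
point whose stabilizer carries a nontrivial character `f` must vanish; at the other points its value
is free. Hence the dimension is the number of grid points (`bijective_restrict`,
`finrank_equivariantFunctions`). The same holds on the dual side, where the labels are `M` times the
corresponding points.

The transform sends `f` to `z ↦ ∑ f(a) e^{-2πi M⟨z, a⟩}`, summed over `a` modulo `Q^∨`. The shift of
each lattice is the twist in the character of the other group, so the sum is well defined and the
result is equivariant for the conjugate dual character (`fourierTransform_mem`). It is injective
because distinct classes modulo `Q^∨`, the dual lattice of `P`, give distinct and thus linearly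
independent characters of `P` (`fourierLinearMap_injective`). Conjugation does not change where a
character is trivial, so this gives one inequality; the hypotheses are symmetric in the two sides,
which gives the other.

What remains is that `F` is a strict fundamental domain (`isStrictFundamentalDomain`). Existence:
the point of an orbit nearest to an interior point of the alcove lies in `F`, since otherwise a
reflection in a wall would bring it nearer. Uniqueness: write the group element as a word in the
simple affine reflections and shorten it by the exchange property (`exchange`,
`reflectionWord_eq_of_mem`). -/

namespace OrbitGrid

/-! ### Equivariant functions and their dimension -/

section EquivariantFunctions

variable {V : Type*} [AddCommGroup V] [Module ℝ V]

/-- The functions supported on `X` that transform under `G` by the character `γ`. -/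
def equivariantFunctions (G : Subgroup (V ≃ᵃ[ℝ] V)) (γ : G →* ℂ) (X : Set V) :
    Submodule ℂ (V → ℂ) where
  carrier := {f | (∀ a ∉ X, f a = 0) ∧ ∀ (g : G), ∀ a ∈ X, f (g.1 a) = γ g * f a}
  zero_mem' := by simp
  add_mem' {f f'} hf hf' := by
    refine ⟨fun a ha => by simp [hf.1 a ha, hf'.1 a ha], fun g a ha => ?_⟩
    simp only [Pi.add_apply, hf.2 g a ha, hf'.2 g a ha]
    ring
  smul_mem' c f hf := by
    refine ⟨fun a ha => by simp [hf.1 a ha], fun g a ha => ?_⟩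
    simp only [Pi.smul_apply, hf.2 g a ha, smul_eq_mul]
    ring

/-- Each `G`-orbit meets `F` in exactly one point. -/
structure IsStrictFundamentalDomain (G : Subgroup (V ≃ᵃ[ℝ] V)) (F : Set V) : Prop where
  exists_mem : ∀ a, ∃ g ∈ G, g a ∈ F
  eq_of_mem : ∀ g ∈ G, ∀ a ∈ F, g a ∈ F → g a = a

/-- The points of `X ∩ F` on whose stabilizer `γ` is trivial. -/
def trivialPoints (G : Subgroup (V ≃ᵃ[ℝ] V)) (γ : G →* ℂ) (X F : Set V) : Set V :=
  {a | (a ∈ X ∧ a ∈ F) ∧ ∀ g : G, g.1 a = a → γ g = 1}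

variable {G : Subgroup (V ≃ᵃ[ℝ] V)} {γ : G →* ℂ} {X F : Set V}

theorem equivariantFunctions_eq_zero {f : V → ℂ} (hf : f ∈ equivariantFunctions G γ X) {a : V}
    (haX : a ∈ X) {g : G} (hg : g.1 a = a) (hγ : γ g ≠ 1) : f a = 0 := by
  have h := hf.2 g a haX
  rw [hg] at h
  have h2 : (γ g - 1) * f a = 0 := by rw [sub_mul, ← h]; ring
  exact (mul_eq_zero.1 h2).resolve_left (sub_ne_zero.2 hγ)

theorem character_ne_zero (g : G) : γ g ≠ 0 := fun h => by
  have : γ (g * g⁻¹) = 0 := by rw [map_mul, h, zero_mul]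
  simp at this

/-- A function transforming by `γ` is determined by its values on `trivialPoints`, and these
values are arbitrary. -/
theorem bijective_restrict (hF : IsStrictFundamentalDomain G F)
    (hX : ∀ g ∈ G, ∀ a, g a ∈ X ↔ a ∈ X) :
    Function.Bijective ((LinearMap.funLeft ℂ ℂ
      ((↑) : trivialPoints G γ X F → V)).domRestrict (equivariantFunctions G γ X)) := by
  constructor
  · rw [← LinearMap.ker_eq_bot, LinearMap.ker_eq_bot']
    rintro ⟨f, hf⟩ h0
    have h0' : ∀ a : trivialPoints G γ X F, f a = 0 := fun a => congrFun h0 a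
    have hXF : ∀ a ∈ X, a ∈ F → f a = 0 := by
      intro a haX haF
      by_cases h : ∀ g : G, g.1 a = a → γ g = 1
      · exact h0' ⟨a, ⟨haX, haF⟩, h⟩
      · push Not at h
        obtain ⟨g, hg, hγ⟩ := h
        exact equivariantFunctions_eq_zero hf haX hg hγ
    ext a
    by_cases ha : a ∈ X
    · obtain ⟨g, hg, hga⟩ := hF.exists_mem a
      have h1 := hf.2 ⟨g, hg⟩ a ha
      rw [hXF _ ((hX g hg a).2 ha) hga] at h1
      exact (mul_eq_zero.1 h1.symm).resolve_left (character_ne_zero _)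
    · exact hf.1 a ha
  · classical
    intro v
    choose r hrG hrF using hF.exists_mem
    -- Transport the value at the orbit representative back to `a`. The value 0 covers both points
    -- off `X` and orbits whose stabilizer character is nontrivial.
    let f : V → ℂ := fun a => if h : r a a ∈ trivialPoints G γ X F then
      γ (⟨r a, hrG a⟩⁻¹) * v ⟨_, h⟩ else 0
    have hf : f ∈ equivariantFunctions G γ X := by
      refine ⟨fun a ha => ?_, fun g a ha => ?_⟩
      · have : r a a ∉ trivialPoints G γ X F := fun h => ha ((hX _ (hrG a) a).1 h.1.1)
        simp [f, this]
      · let k : G := ⟨r (g.1 a), hrG _⟩ * g * ⟨r a, hrG a⟩⁻¹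
        have hk : k.1 (r a a) = r (g.1 a) (g.1 a) := by
          simp [k, AffineEquiv.inv_def]
        have hks : k.1 (r a a) = r a a :=
          hF.eq_of_mem _ k.2 _ (hrF a) (by rw [hk]; exact hrF _)
        have heq : r (g.1 a) (g.1 a) = r a a := hk.symm.trans hks
        by_cases h : r a a ∈ trivialPoints G γ X F
        · have h' : r (g.1 a) (g.1 a) ∈ trivialPoints G γ X F := by rwa [heq]
          have h1 : γ k = 1 := h.2 k hks
          have h2 : (⟨r (g.1 a), hrG _⟩ : G)⁻¹ * k = g * ⟨r a, hrG a⟩⁻¹ := by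
            simp only [k]; group
          have h3 : γ (⟨r (g.1 a), hrG _⟩⁻¹) = γ g * γ (⟨r a, hrG a⟩⁻¹) := by
            rw [← map_mul, ← h2, map_mul, h1, mul_one]
          have h4 : (⟨_, h'⟩ : trivialPoints G γ X F) = ⟨_, h⟩ := Subtype.ext heq
          simp only [f, h, h', dif_pos, h3, h4]
          ring
        · have h' : r (g.1 a) (g.1 a) ∉ trivialPoints G γ X F := by rwa [heq]
          simp [f, h, h']
    refine ⟨⟨f, hf⟩, ?_⟩
    ext ⟨a, ha⟩
    have h1 : r a a = a := hF.eq_of_mem _ (hrG a) a ha.1.2 (hrF a)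
    have h2 : r a a ∈ trivialPoints G γ X F := by rwa [h1]
    have h3 : γ (⟨r a, hrG a⟩⁻¹) = 1 := by
      refine ha.2 _ ?_
      change (r a)⁻¹ a = a
      rw [AffineEquiv.inv_def, AffineEquiv.symm_apply_eq, h1]
    have h4 : (⟨_, h2⟩ : trivialPoints G γ X F) = ⟨a, ha⟩ := Subtype.ext h1
    change f a = v ⟨a, ha⟩
    simp only [f, h2, dif_pos, h3, h4, one_mul]

theorem finrank_equivariantFunctions (hF : IsStrictFundamentalDomain G F)
    (hX : ∀ g ∈ G, ∀ a, g a ∈ X ↔ a ∈ X) (hfin : (X ∩ F).Finite) :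
    FiniteDimensional ℂ (equivariantFunctions G γ X) ∧
    Module.finrank ℂ (equivariantFunctions G γ X) = (trivialPoints G γ X F).ncard := by
  have : Finite (trivialPoints G γ X F) := hfin.subset fun a ha => ha.1
  have := Fintype.ofFinite (trivialPoints G γ X F)
  let e := LinearEquiv.ofBijective _ (bijective_restrict (γ := γ) hF hX)
  refine ⟨e.symm.finiteDimensional, ?_⟩
  rw [e.finrank_eq, Module.finrank_fintype_fun_eq_card, ← Nat.card_coe_set_eq,
    Nat.card_eq_fintype_card]

end EquivariantFunctions

/-! ### The exponential `e^{2πir}` -/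

/-- The number `e^{2πir}`. -/
noncomputable def expTwoPi (r : ℝ) : ℂ := Complex.exp (2 * Real.pi * Complex.I * (r : ℝ))

theorem expTwoPi_add (r s : ℝ) : expTwoPi (r + s) = expTwoPi r * expTwoPi s := by
  simp [expTwoPi, ← Complex.exp_add, mul_add]

theorem expTwoPi_ne_zero (r : ℝ) : expTwoPi r ≠ 0 := Complex.exp_ne_zero _

theorem expTwoPi_eq_one_iff (r : ℝ) : expTwoPi r = 1 ↔ ∃ n : ℤ, r = n := by
  rw [expTwoPi, Complex.exp_eq_one_iff]
  refine exists_congr fun n => ?_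
  have h : (2 * Real.pi * Complex.I : ℂ) ≠ 0 := by simp [Real.pi_ne_zero]
  rw [mul_comm, mul_left_inj' h]
  norm_cast

theorem expTwoPi_eq_iff (r s : ℝ) : expTwoPi r = expTwoPi s ↔ ∃ n : ℤ, r - s = n := by
  have h : expTwoPi r = expTwoPi (r - s) * expTwoPi s := by rw [← expTwoPi_add, sub_add_cancel]
  rw [← expTwoPi_eq_one_iff, h]
  exact mul_eq_right₀ (expTwoPi_ne_zero s)

theorem expTwoPi_congr {r s : ℝ} {n : ℤ} (h : r = s + n) : expTwoPi r = expTwoPi s :=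
  (expTwoPi_eq_iff r s).2 ⟨n, by rw [h]; ring⟩

theorem conj_expTwoPi (r : ℝ) : starRingEnd ℂ (expTwoPi r) = expTwoPi (-r) := by
  simp [expTwoPi, ← Complex.exp_conj, Complex.conj_ofNat]

/-! ### Shifted dual lattices and the character `γ` -/

section Duality

variable {V : Type*} [NormedAddCommGroup V] [InnerProductSpace ℝ V]

/-- Two dual pairs of `W`-stable lattices together with admissible shifts. -/
structure IsShiftedDuality (W : Subgroup (V ≃ₗ[ℝ] V)) (L₁ K₁ L₂ K₂ : AddSubgroup V)
    (ρ₁ ρ₂ : V) : Prop where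
  inner_map : ∀ w ∈ W, ∀ x y, ⟪w x, w y⟫ = ⟪x, y⟫
  stable₁ : ∀ w ∈ W, ∀ x ∈ K₁, w x ∈ K₁
  stable₂ : ∀ w ∈ W, ∀ x ∈ K₂, w x ∈ K₂
  map_mem₁ : ∀ w ∈ W, ∀ x ∈ L₁, w x ∈ L₁
  map_mem₂ : ∀ w ∈ W, ∀ x ∈ L₂, w x ∈ L₂
  shift₁ : ∀ w ∈ W, w ρ₁ - ρ₁ ∈ L₁
  shift₂ : ∀ w ∈ W, w ρ₂ - ρ₂ ∈ L₂
  le₁ : K₁ ≤ L₁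
  le₂ : K₂ ≤ L₂
  integral₁ : ∀ x ∈ L₁, ∀ q ∈ K₂, ∃ n : ℤ, ⟪x, q⟫ = n
  integral₂ : ∀ x ∈ L₂, ∀ q ∈ K₁, ∃ n : ℤ, ⟪x, q⟫ = n
  dual₁ : ∀ v, (∀ y ∈ L₂, ∃ n : ℤ, ⟪y, v⟫ = n) → v ∈ K₁
  dual₂ : ∀ v, (∀ y ∈ L₁, ∃ n : ℤ, ⟪y, v⟫ = n) → v ∈ K₂

/-- The scaled shifted lattice `(1/M)(ρ + L)`. -/
def shiftedLattice (M : ℕ) (L : AddSubgroup V) (ρ : V) : Set V :=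
  {a | ∃ x ∈ L, a = (1 / (M : ℝ)) • (ρ + x)}

variable {W : Subgroup (V ≃ₗ[ℝ] V)} {L₁ K₁ L₂ K₂ : AddSubgroup V} {ρ₁ ρ₂ : V}

theorem IsShiftedDuality.symm (h : IsShiftedDuality W L₁ K₁ L₂ K₂ ρ₁ ρ₂) :
    IsShiftedDuality W L₂ K₂ L₁ K₁ ρ₂ ρ₁ :=
  ⟨h.inner_map, h.stable₂, h.stable₁, h.map_mem₂, h.map_mem₁, h.shift₂, h.shift₁, h.le₂, h.le₁,
    h.integral₂, h.integral₁, h.dual₂, h.dual₁⟩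

theorem affineEquiv_apply (g : V ≃ᵃ[ℝ] V) (a : V) : g a = g.linear a + g 0 := by
  simpa using g.map_vadd 0 a

theorem gamma_eq (σ : W →* ℤˣ) (ρ : V) (g : V ≃ᵃ[ℝ] V) (hg : g.linear ∈ W) :
    gamma σ ρ g hg = expTwoPi ⟪g 0, ρ⟫ * ((σ ⟨g.linear, hg⟩ : ℤ) : ℂ) := rfl

theorem inner_map_eq (h : IsShiftedDuality W L₁ K₁ L₂ K₂ ρ₁ ρ₂) {w : V ≃ₗ[ℝ] V} (hw : w ∈ W)
    (x y : V) : ⟪w x, y⟫ = ⟪x, w⁻¹ y⟫ := by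
  rw [← h.inner_map w hw x]
  congr 1
  exact (w.apply_symm_apply y).symm

/-- The map `gamma` is a character of the affine group when the shift is admissible. -/
noncomputable def gammaHom (h : IsShiftedDuality W L₁ K₁ L₂ K₂ ρ₁ ρ₂) (σ : W →* ℤˣ) :
    affineGroup W K₁ h.stable₁ →* ℂ where
  toFun g := gamma σ ρ₂ g.1 g.2.1
  map_one' := by
    rw [gamma_eq]
    have : (⟨(1 : V ≃ᵃ[ℝ] V).linear, (1 : affineGroup W K₁ h.stable₁).2.1⟩ : W) = 1 := rfl
    simp [expTwoPi, this]
  map_mul' g g' := by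
    simp only [gamma_eq]
    have h1 : (⟨(g * g').1.linear, (g * g').2.1⟩ : W) = ⟨g.1.linear, g.2.1⟩ * ⟨g'.1.linear, g'.2.1⟩ :=
      rfl
    -- With `w` the linear part of `g`, multiplicativity fails only by `⟪w⁻¹ ρ₂ - ρ₂, g' 0⟫`;
    -- admissibility puts the first entry in `L₂`, so this is an integer.
    obtain ⟨n, hn⟩ := h.integral₂ _ (h.shift₂ _ (W.inv_mem g.2.1)) _ g'.2.2
    have h2 : expTwoPi ⟪(g * g').1 0, ρ₂⟫ = expTwoPi (⟪g.1 0, ρ₂⟫ + ⟪g'.1 0, ρ₂⟫) := by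
      refine expTwoPi_congr (n := n) ?_
      have h3 : (g * g').1 0 = g.1.linear (g'.1 0) + g.1 0 := affineEquiv_apply g.1 (g'.1 0)
      rw [h3, inner_add_left, inner_map_eq h g.2.1, ← hn, real_inner_comm, inner_sub_left,
        real_inner_comm (g'.1 0) ρ₂]
      ring
    rw [h1, h2, expTwoPi_add, map_mul]
    push_cast
    ring

/-- For `g = T(q) w`, `M g((ρ₁ + x)/M) = ρ₁ + (w ρ₁ - ρ₁) + w x + M q`, and the last three terms lie
in `L₁`. -/
theorem affine_mem_shiftedLattice (h : IsShiftedDuality W L₁ K₁ L₂ K₂ ρ₁ ρ₂) {M : ℕ} (hM : 0 < M)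
    {g : V ≃ᵃ[ℝ] V} (hg : g ∈ affineGroup W K₁ h.stable₁) {a : V}
    (ha : a ∈ shiftedLattice M L₁ ρ₁) : g a ∈ shiftedLattice M L₁ ρ₁ := by
  obtain ⟨x, hx, rfl⟩ := ha
  have hM' : (M : ℝ) ≠ 0 := by positivity
  refine ⟨(g.linear ρ₁ - ρ₁) + g.linear x + M • g 0, ?_, ?_⟩
  · exact add_mem (add_mem (h.shift₁ _ hg.1) (h.map_mem₁ _ hg.1 _ hx))
      (AddSubgroup.nsmul_mem _ (h.le₁ hg.2) _)
  · rw [affineEquiv_apply g, map_smul, map_add, ← Nat.cast_smul_eq_nsmul ℝ]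
    have : g 0 = (1 / (M : ℝ)) • ((M : ℝ) • g 0) := by rw [smul_smul]; field_simp; simp
    nth_rewrite 1 [this]
    rw [← smul_add]
    congr 1
    abel

theorem affine_mem_shiftedLattice_iff (h : IsShiftedDuality W L₁ K₁ L₂ K₂ ρ₁ ρ₂) {M : ℕ}
    (hM : 0 < M) (g : V ≃ᵃ[ℝ] V) (hg : g ∈ affineGroup W K₁ h.stable₁) (a : V) :
    g a ∈ shiftedLattice M L₁ ρ₁ ↔ a ∈ shiftedLattice M L₁ ρ₁ := by
  refine ⟨fun ha => ?_, affine_mem_shiftedLattice h hM hg⟩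
  have := affine_mem_shiftedLattice h hM (Subgroup.inv_mem _ hg) ha
  rwa [AffineEquiv.inv_def, AffineEquiv.symm_apply_apply] at this

end Duality

/-! ### The discrete Fourier transform -/

section Fourier

variable {V : Type*} [NormedAddCommGroup V] [InnerProductSpace ℝ V]
  {W : Subgroup (V ≃ₗ[ℝ] V)} {L₁ K₁ L₂ K₂ : AddSubgroup V} {ρ₁ ρ₂ : V}

/-- The functions on `(1/M)(ρ₁ + L₁)` that transform by `gammaHom`. -/
noncomputable abbrev gammaFunctions (h : IsShiftedDuality W L₁ K₁ L₂ K₂ ρ₁ ρ₂) (σ : W →* ℤˣ) (M : ℕ) :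
    Submodule ℂ (V → ℂ) :=
  equivariantFunctions (affineGroup W K₁ h.stable₁) (gammaHom h σ) (shiftedLattice M L₁ ρ₁)

/-- The functions on `(1/M)(ρ₁ + L₁)` that transform by the conjugate of `gammaHom`. -/
noncomputable abbrev conjGammaFunctions (h : IsShiftedDuality W L₁ K₁ L₂ K₂ ρ₁ ρ₂) (σ : W →* ℤˣ) (M : ℕ) :
    Submodule ℂ (V → ℂ) :=
  equivariantFunctions (affineGroup W K₁ h.stable₁)
    ((starRingEnd ℂ).toMonoidHom.comp (gammaHom h σ)) (shiftedLattice M L₁ ρ₁)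

theorem gammaHom_apply (h : IsShiftedDuality W L₁ K₁ L₂ K₂ ρ₁ ρ₂) (σ : W →* ℤˣ)
    (g : affineGroup W K₁ h.stable₁) (w : W) (hw : g.1.linear = w) :
    gammaHom h σ g = expTwoPi ⟪g.1 0, ρ₂⟫ * ((σ w : ℤ) : ℂ) := by
  obtain rfl : w = ⟨g.1.linear, g.2.1⟩ := Subtype.ext hw.symm
  rfl

theorem gammaFunctions_map_linear (h : IsShiftedDuality W L₁ K₁ L₂ K₂ ρ₁ ρ₂) {σ : W →* ℤˣ}
    {M : ℕ} (hM : 0 < M) {f : V → ℂ} (hf : f ∈ gammaFunctions h σ M) (w : W) (a : V) :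
    f (w.1 a) = ((σ w : ℤ) : ℂ) * f a := by
  let g : affineGroup W K₁ h.stable₁ := ⟨w.1.toAffineEquiv, w.2, by simp [K₁.zero_mem]⟩
  by_cases ha : a ∈ shiftedLattice M L₁ ρ₁
  · have h1 := hf.2 g a ha
    have h2 : gammaHom h σ g = ((σ w : ℤ) : ℂ) := by
      have h0 : g.1 0 = 0 := by simp [g]
      rw [gammaHom_apply h σ g w rfl, h0, inner_zero_left]
      simp [expTwoPi]
    rw [h2] at h1
    exact h1
  · have h1 : w.1 a ∉ shiftedLattice M L₁ ρ₁ := fun h' =>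
      ha ((affine_mem_shiftedLattice_iff h hM g.1 g.2 a).1 h')
    rw [hf.1 a ha, hf.1 _ h1, mul_zero]

theorem gammaFunctions_add (h : IsShiftedDuality W L₁ K₁ L₂ K₂ ρ₁ ρ₂) {σ : W →* ℤˣ}
    {M : ℕ} (hM : 0 < M) {f : V → ℂ} (hf : f ∈ gammaFunctions h σ M) {q : V} (hq : q ∈ K₁)
    (a : V) : f (a + q) = expTwoPi ⟪q, ρ₂⟫ * f a := by
  let g : affineGroup W K₁ h.stable₁ :=
    ⟨AffineEquiv.constVAdd ℝ V q, W.one_mem, by simpa using hq⟩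
  have hg : ∀ x, g.1 x = x + q := fun x => by simp [g, add_comm]
  by_cases ha : a ∈ shiftedLattice M L₁ ρ₁
  · have h1 := hf.2 g a ha
    have h2 : gammaHom h σ g = expTwoPi ⟪q, ρ₂⟫ := by
      rw [gammaHom_apply h σ g 1 rfl, hg, zero_add]
      simp
    rwa [h2, hg] at h1
  · have h1 : a + q ∉ shiftedLattice M L₁ ρ₁ := fun h' =>
      ha ((affine_mem_shiftedLattice_iff h hM g.1 g.2 a).1 (by rwa [hg]))
    rw [hf.1 a ha, hf.1 _ h1, mul_zero]

/-- The summand of the discrete Fourier transform. -/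
noncomputable def fourierSummand (M : ℕ) (f : V → ℂ) (z a : V) : ℂ :=
  f a * expTwoPi (-(M * ⟪z, a⟫))

/-- The factor `e^{2πi⟨q, ρ₂⟩}` gained by `f` cancels against the exponential, because `M z ∈ ρ₂ +
L₂` and `L₂` pairs integrally with `K₁`. Hence summation over `V ⧸ K₁` does not depend on
representatives. -/
theorem fourierSummand_add (h : IsShiftedDuality W L₁ K₁ L₂ K₂ ρ₁ ρ₂) {σ : W →* ℤˣ}
    {M : ℕ} (hM : 0 < M) {f : V → ℂ} (hf : f ∈ gammaFunctions h σ M) {z : V}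
    (hz : z ∈ shiftedLattice M L₂ ρ₂) {q : V} (hq : q ∈ K₁) (a : V) :
    fourierSummand M f z (a + q) = fourierSummand M f z a := by
  obtain ⟨y, hy, rfl⟩ := hz
  obtain ⟨n, hn⟩ := h.integral₂ y hy q hq
  have hM' : (M : ℝ) ≠ 0 := by positivity
  rw [fourierSummand, fourierSummand, gammaFunctions_add h hM hf hq, mul_comm (expTwoPi _),
    mul_assoc, ← expTwoPi_add]
  congr 1
  refine expTwoPi_congr (n := -n) ?_
  rw [inner_add_right, real_inner_smul_left, real_inner_smul_left, inner_add_left _ _ q, hn,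
    real_inner_comm]
  field_simp
  push_cast
  ring

theorem fourierSummand_out (h : IsShiftedDuality W L₁ K₁ L₂ K₂ ρ₁ ρ₂) {σ : W →* ℤˣ}
    {M : ℕ} (hM : 0 < M) {f : V → ℂ} (hf : f ∈ gammaFunctions h σ M) {z : V}
    (hz : z ∈ shiftedLattice M L₂ ρ₂) (a : V) :
    fourierSummand M f z (a : V ⧸ K₁).out = fourierSummand M f z a := by
  obtain ⟨q, hq⟩ := QuotientAddGroup.mk_out_eq_add K₁ a
  rw [hq, fourierSummand_add h hM hf hz q.2]

open Classical in
/-- The discrete Fourier transform of a function on `(1/M)(ρ₁ + L₁)`, a function on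
`(1/M)(ρ₂ + L₂)`. -/
noncomputable def fourierTransform (M : ℕ) (K₁ L₂ : AddSubgroup V) (ρ₂ : V) (f : V → ℂ) (z : V) :
    ℂ :=
  if z ∈ shiftedLattice M L₂ ρ₂ then ∑ᶠ t : V ⧸ K₁, fourierSummand M f z t.out else 0

/-- The linear part of `g` is absorbed by reindexing the sum over `V ⧸ K₁`, which costs the sign
`σ`; the translation part produces the phase `e^{-2πi⟨g 0, ρ₁⟩}`. -/
theorem fourierTransform_mem (h : IsShiftedDuality W L₁ K₁ L₂ K₂ ρ₁ ρ₂) {σ : W →* ℤˣ}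
    {M : ℕ} (hM : 0 < M) {f : V → ℂ} (hf : f ∈ gammaFunctions h σ M) :
    fourierTransform M K₁ L₂ ρ₂ f ∈ conjGammaFunctions h.symm σ M := by
  refine ⟨fun z hz => if_neg hz, fun g z hz => ?_⟩
  have hgz := affine_mem_shiftedLattice h.symm hM g.2 hz
  have hw : g.1.linear ∈ W := g.2.1
  rw [fourierTransform, fourierTransform, if_pos hz, if_pos hgz]
  change _ = starRingEnd ℂ (gamma σ ρ₁ g.1 g.2.1) * _
  rw [gamma_eq, map_mul, conj_expTwoPi, map_intCast, ← smul_eq_mul, smul_finsum]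
  let e : (V ⧸ K₁) ≃+ (V ⧸ K₁) := QuotientAddGroup.congr K₁ K₁ g.1.linear.toAddEquiv (by
    ext x
    constructor
    · rintro ⟨y, hy, rfl⟩
      exact h.stable₁ _ hw y hy
    · intro hx
      exact ⟨g.1.linear⁻¹ x, h.stable₁ _ (W.inv_mem hw) x hx, g.1.linear.apply_symm_apply x⟩)
  rw [← finsum_comp_equiv e.toEquiv]
  refine finsum_congr fun t => ?_
  induction t using QuotientAddGroup.induction_on with | _ a => ?_
  have he : e.toEquiv (a : V ⧸ K₁) = ((g.1.linear a : V) : V ⧸ K₁) := rfl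
  rw [he, fourierSummand_out h hM hf hgz, fourierSummand_out h hM hf hz, fourierSummand,
    fourierSummand, gammaFunctions_map_linear h hM hf ⟨_, hw⟩, smul_eq_mul]
  -- The phase identity `key` needs `M w a ∈ ρ₁ + L₁`, which is available only where `f` may be
  -- nonzero.
  by_cases hfa : f a = 0
  · simp [hfa]
  have ha : a ∈ shiftedLattice M L₁ ρ₁ := by
    by_contra ha
    exact hfa (hf.1 a ha)
  have hwa : g.1.linear a ∈ shiftedLattice M L₁ ρ₁ :=
    affine_mem_shiftedLattice h hM (g := g.1.linear.toAffineEquiv)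
      ⟨hw, by simp [K₁.zero_mem]⟩ ha
  have key : expTwoPi (-(M * ⟪g.1 z, g.1.linear a⟫)) =
      expTwoPi (-⟪g.1 0, ρ₁⟫) * expTwoPi (-(M * ⟪z, a⟫)) := by
    obtain ⟨x, hx, hwx⟩ := hwa
    obtain ⟨n, hn⟩ := h.integral₁ x hx (g.1 0) g.2.2
    rw [← expTwoPi_add]
    refine expTwoPi_congr (n := -n) ?_
    rw [affineEquiv_apply g.1 z, inner_add_left, h.inner_map _ hw, hwx, real_inner_smul_right,
      inner_add_right, real_inner_comm x, hn]
    have hM' : (M : ℝ) ≠ 0 := by positivity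
    field_simp
    push_cast
    ring
  rw [key]
  ring

theorem finite_support_fourierSummand (h : IsShiftedDuality W L₁ K₁ L₂ K₂ ρ₁ ρ₂) {σ : W →* ℤˣ}
    {M : ℕ} (hT : ((QuotientAddGroup.mk : V → V ⧸ K₁) '' shiftedLattice M L₁ ρ₁).Finite)
    {f : V → ℂ} (hf : f ∈ gammaFunctions h σ M) (z : V) :
    (Function.support fun t : V ⧸ K₁ => fourierSummand M f z t.out) ⊆ hT.toFinset := by
  intro t ht
  rw [Set.Finite.coe_toFinset]
  refine ⟨t.out, ?_, QuotientAddGroup.out_eq' t⟩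
  by_contra h'
  exact ht (by simp [fourierSummand, hf.1 _ h'])

/-- The Fourier transform as a linear map. -/
noncomputable def fourierLinearMap (h : IsShiftedDuality W L₁ K₁ L₂ K₂ ρ₁ ρ₂) (σ : W →* ℤˣ)
    {M : ℕ} (hM : 0 < M)
    (hT : ((QuotientAddGroup.mk : V → V ⧸ K₁) '' shiftedLattice M L₁ ρ₁).Finite) :
    gammaFunctions h σ M →ₗ[ℂ] conjGammaFunctions h.symm σ M where
  toFun f := ⟨_, fourierTransform_mem h hM f.2⟩
  map_add' f f' := by
    ext z
    have hs := fun f : gammaFunctions h σ M => finite_support_fourierSummand h hT f.2 z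
    simp only [fourierTransform, Submodule.coe_add, Pi.add_apply]
    split_ifs
    · rw [← finsum_add_distrib (hT.subset (by simpa using hs f)) (hT.subset (by simpa using hs f'))]
      exact finsum_congr fun t => by simp [fourierSummand, add_mul]
    · simp
  map_smul' c f := by
    ext z
    simp only [fourierTransform, Submodule.coe_smul, Pi.smul_apply, RingHom.id_apply]
    split_ifs
    · rw [smul_finsum]
      exact finsum_congr fun t => by simp [fourierSummand, mul_assoc]
    · simp

/-- The character `y ↦ e^{-2πi⟨y, a⟩}` of a lattice. -/
noncomputable def latticeCharacter (L : AddSubgroup V) (a : V) : Multiplicative L →* ℂ where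
  toFun y := expTwoPi (-⟪(y.toAdd : V), a⟫)
  map_one' := by simp [expTwoPi]
  map_mul' y y' := by simp [← expTwoPi_add, inner_add_left, add_comm]

/-- At `z = (ρ₂ + y)/M` the transform is a combination of the characters `y ↦ e^{-2πi⟨y, t⟩}` of
`L₂` with coefficients `f(t) e^{-2πi⟨ρ₂, t⟩}`. By `dual₁` distinct classes `t` give distinct
characters, so Dedekind independence kills every coefficient. -/
theorem fourierLinearMap_injective (h : IsShiftedDuality W L₁ K₁ L₂ K₂ ρ₁ ρ₂) (σ : W →* ℤˣ)
    {M : ℕ} (hM : 0 < M)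
    (hT : ((QuotientAddGroup.mk : V → V ⧸ K₁) '' shiftedLattice M L₁ ρ₁).Finite) :
    Function.Injective (fourierLinearMap h σ hM hT) := by
  rw [← LinearMap.ker_eq_bot, LinearMap.ker_eq_bot']
  rintro ⟨f, hf⟩ h0
  have hM' : (M : ℝ) ≠ 0 := by positivity
  have h0' : ∀ z, fourierTransform M K₁ L₂ ρ₂ f z = 0 := fun z =>
    congrFun (congrArg Subtype.val h0) z
  have hinj : Function.Injective fun t : V ⧸ K₁ => latticeCharacter L₂ t.out := by
    intro t t' htt
    rw [← QuotientAddGroup.out_eq' t, ← QuotientAddGroup.out_eq' t', QuotientAddGroup.eq]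
    refine h.dual₁ _ fun y hy => ?_
    have h1 : expTwoPi (-⟪y, t.out⟫) = expTwoPi (-⟪y, t'.out⟫) :=
      DFunLike.congr_fun htt (Multiplicative.ofAdd (⟨y, hy⟩ : L₂))
    obtain ⟨n, hn⟩ := (expTwoPi_eq_iff _ _).1 h1
    exact ⟨n, by rw [← hn, inner_add_right, inner_neg_right]; ring⟩
  have hli := (linearIndependent_monoidHom (Multiplicative L₂) ℂ).comp _ hinj
  have hcoef := linearIndependent_iff'.1 hli hT.toFinset
    (fun t => f t.out * expTwoPi (-⟪ρ₂, t.out⟫)) (by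
      ext y
      have hz : (1 / (M : ℝ)) • (ρ₂ + (y.toAdd : V)) ∈ shiftedLattice M L₂ ρ₂ :=
        ⟨_, y.toAdd.2, rfl⟩
      have h1 := h0' ((1 / (M : ℝ)) • (ρ₂ + (y.toAdd : V)))
      rw [fourierTransform, if_pos hz, finsum_eq_sum_of_support_subset _
        (finite_support_fourierSummand h hT hf _)] at h1
      rw [Finset.sum_apply, Pi.zero_apply, ← h1]
      refine Finset.sum_congr rfl fun t _ => ?_
      change f t.out * expTwoPi (-⟪ρ₂, t.out⟫) * expTwoPi (-⟪(y.toAdd : V), t.out⟫) = _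
      rw [fourierSummand, mul_assoc, ← expTwoPi_add, real_inner_smul_left, inner_add_left]
      congr 2
      field_simp
      ring)
  ext a
  by_cases ha : a ∈ shiftedLattice M L₁ ρ₁
  · have h1 := hcoef (a : V ⧸ K₁) (by rw [Set.Finite.mem_toFinset]; exact ⟨a, ha, rfl⟩)
    have h2 := (mul_eq_zero.1 h1).resolve_right (expTwoPi_ne_zero _)
    obtain ⟨q, hq⟩ := QuotientAddGroup.mk_out_eq_add K₁ a
    rw [hq, gammaFunctions_add h hM hf q.2] at h2
    exact (mul_eq_zero.1 h2).resolve_left (expTwoPi_ne_zero _)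
  · exact hf.1 a ha

theorem trivialPoints_conj {G : Subgroup (V ≃ᵃ[ℝ] V)} (γ : G →* ℂ) (X F : Set V) :
    trivialPoints G ((starRingEnd ℂ).toMonoidHom.comp γ) X F = trivialPoints G γ X F := by
  ext a
  refine and_congr_right fun _ => forall_congr' fun g => imp_congr_right fun _ => ?_
  exact map_eq_one_iff (starRingEnd ℂ) (starRingEnd ℂ).injective

/-- Modulo `K₁` every lattice point is `w` applied to one of the finitely many lattice points in
`F`, and `W` is finite. -/
theorem finite_image_mk (h : IsShiftedDuality W L₁ K₁ L₂ K₂ ρ₁ ρ₂) {M : ℕ} (hM : 0 < M)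
    {F : Set V} (hF : IsStrictFundamentalDomain (affineGroup W K₁ h.stable₁) F)
    (hfin : (shiftedLattice M L₁ ρ₁ ∩ F).Finite) [Finite W] :
    ((QuotientAddGroup.mk : V → V ⧸ K₁) '' shiftedLattice M L₁ ρ₁).Finite := by
  refine ((Set.finite_univ (α := W)).prod hfin |>.image
    fun p => ((p.1.1 p.2 : V) : V ⧸ K₁)).subset ?_
  rintro _ ⟨a, ha, rfl⟩
  obtain ⟨g, hg, hga⟩ := hF.exists_mem a
  have hg' := Subgroup.inv_mem _ hg
  refine ⟨(⟨_, hg'.1⟩, g a), ⟨trivial, affine_mem_shiftedLattice h hM hg ha, hga⟩, ?_⟩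
  rw [QuotientAddGroup.eq]
  have h1 := affineEquiv_apply g⁻¹ (g a)
  have h2 : g⁻¹ (g a) = a := by rw [AffineEquiv.inv_def, AffineEquiv.symm_apply_apply]
  rw [h2] at h1
  have h3 : -(g⁻¹).linear (g a) + a = g⁻¹ 0 := by nth_rewrite 2 [h1]; abel
  simpa only [h3] using hg'.2

/-- Both sides are dimensions, and the Fourier transform embeds the first space in the second. -/
theorem ncard_trivialPoints_le (h : IsShiftedDuality W L₁ K₁ L₂ K₂ ρ₁ ρ₂) (σ : W →* ℤˣ)
    {M : ℕ} (hM : 0 < M) [Finite W] {F₁ F₂ : Set V}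
    (hF₁ : IsStrictFundamentalDomain (affineGroup W K₁ h.stable₁) F₁)
    (hF₂ : IsStrictFundamentalDomain (affineGroup W K₂ h.stable₂) F₂)
    (hfin₁ : (shiftedLattice M L₁ ρ₁ ∩ F₁).Finite) (hfin₂ : (shiftedLattice M L₂ ρ₂ ∩ F₂).Finite) :
    (trivialPoints _ (gammaHom h σ) (shiftedLattice M L₁ ρ₁) F₁).ncard ≤
      (trivialPoints _ (gammaHom h.symm σ) (shiftedLattice M L₂ ρ₂) F₂).ncard := by
  have hT := finite_image_mk h hM hF₁ hfin₁
  have h1 := finrank_equivariantFunctions (γ := gammaHom h σ) hF₁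
    (affine_mem_shiftedLattice_iff h hM) hfin₁
  have h2 := finrank_equivariantFunctions
    (γ := (starRingEnd ℂ).toMonoidHom.comp (gammaHom h.symm σ)) hF₂
    (affine_mem_shiftedLattice_iff h.symm hM) hfin₂
  rw [trivialPoints_conj] at h2
  rw [← h1.2, ← h2.2]
  have := h2.1
  exact LinearMap.finrank_le_finrank_of_injective (fourierLinearMap_injective h σ hM hT)

/-- The two families of points with trivial stabilizer character are equinumerous. -/
theorem ncard_trivialPoints_eq (h : IsShiftedDuality W L₁ K₁ L₂ K₂ ρ₁ ρ₂) (σ : W →* ℤˣ)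
    {M : ℕ} (hM : 0 < M) [Finite W] {F₁ F₂ : Set V}
    (hF₁ : IsStrictFundamentalDomain (affineGroup W K₁ h.stable₁) F₁)
    (hF₂ : IsStrictFundamentalDomain (affineGroup W K₂ h.stable₂) F₂)
    (hfin₁ : (shiftedLattice M L₁ ρ₁ ∩ F₁).Finite) (hfin₂ : (shiftedLattice M L₂ ρ₂ ∩ F₂).Finite) :
    (trivialPoints _ (gammaHom h σ) (shiftedLattice M L₁ ρ₁) F₁).ncard =
      (trivialPoints _ (gammaHom h.symm σ) (shiftedLattice M L₂ ρ₂) F₂).ncard :=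
  (ncard_trivialPoints_le h σ hM hF₁ hF₂ hfin₁ hfin₂).antisymm
    (ncard_trivialPoints_le h.symm σ hM hF₂ hF₁ hfin₂ hfin₁)

end Fourier

/-! ### Affine roots and their reflections -/

section AffineRoots

variable {ι V : Type*} [NormedAddCommGroup V] [InnerProductSpace ℝ V] {P : RootPairing ι ℝ V V}

/-- The value at `x` of the affine root `⟨α_i, x⟩ + k`. -/
noncomputable def affineValue (P : RootPairing ι ℝ V V) (p : ι × ℤ) (x : V) : ℝ :=
  ⟪P.root p.1, x⟫ + p.2

/-- The reflection in the hyperplane where an affine root vanishes. -/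
noncomputable def affineReflection (P : RootPairing ι ℝ V V) (p : ι × ℤ) : V ≃ᵃ[ℝ] V :=
  (P.coreflection p.1).toAffineEquiv.trans
    (AffineEquiv.constVAdd ℝ V (-((p.2 : ℝ) • P.coroot p.1)))

theorem affineReflection_apply_eq_coreflection (p : ι × ℤ) (x : V) :
    affineReflection P p x = P.coreflection p.1 x - (p.2 : ℝ) • P.coroot p.1 := by
  simp [affineReflection]
  abel

theorem coreflection_apply_inner [IsEuclidean P] (i : ι) (x : V) :
    P.coreflection i x = x - ⟪P.root i, x⟫ • P.coroot i := by
  rw [P.coreflection_apply, RootPairing.root', IsEuclidean.toLinearMap_eq]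

theorem affineReflection_apply [IsEuclidean P] (p : ι × ℤ) (x : V) :
    affineReflection P p x = x - affineValue P p x • P.coroot p.1 := by
  rw [affineReflection_apply_eq_coreflection, coreflection_apply_inner, affineValue, add_smul]
  abel

theorem inner_root_coroot [IsEuclidean P] (i j : ι) : ⟪P.root i, P.coroot j⟫ = P.pairing i j := by
  rw [← IsEuclidean.toLinearMap_eq (P := P), P.root_coroot_eq_pairing]

theorem pairingIn_cast [IsEuclidean P] [P.IsCrystallographic] (i j : ι) :
    (P.pairingIn ℤ i j : ℝ) = ⟪P.root i, P.coroot j⟫ := by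
  rw [inner_root_coroot]
  simpa using P.algebraMap_pairingIn ℤ i j

theorem affineReflection_apply_self [IsEuclidean P] (p : ι × ℤ) (x : V) :
    affineReflection P p (affineReflection P p x) = x := by
  have h2 : ⟪P.root p.1, P.coroot p.1⟫ = 2 := by rw [inner_root_coroot, P.pairing_same]
  rw [affineReflection_apply, affineReflection_apply]
  simp only [affineValue, inner_sub_right, inner_smul_right, h2]
  module

theorem affineReflection_mul_self [IsEuclidean P] (p : ι × ℤ) :
    affineReflection P p * affineReflection P p = 1 :=
  AffineEquiv.ext fun x => affineReflection_apply_self p x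

theorem affineReflection_inv [IsEuclidean P] (p : ι × ℤ) :
    (affineReflection P p)⁻¹ = affineReflection P p :=
  inv_eq_of_mul_eq_one_left (affineReflection_mul_self p)

/-- The image of the affine root `q` under the reflection in `p`. -/
noncomputable def reflectAffineRoot (P : RootPairing ι ℝ V V) [P.IsCrystallographic] (p q : ι × ℤ) : ι × ℤ :=
  (P.reflectionPerm p.1 q.1, q.2 - P.pairingIn ℤ q.1 p.1 * p.2)

section

variable [IsEuclidean P] [P.IsCrystallographic]

theorem root_reflectAffineRoot (p q : ι × ℤ) : P.root (reflectAffineRoot P p q).1 =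
    P.root q.1 - (P.pairingIn ℤ q.1 p.1 : ℝ) • P.root p.1 := by
  rw [reflectAffineRoot, P.root_reflectionPerm, P.reflection_apply, pairingIn_cast,
    inner_root_coroot]
  rfl

/-- Shows that the integer in `reflectAffineRoot` is the right one: reflecting an affine root is
precomposing it, as a function on `V`, with the affine reflection. -/
theorem affineValue_reflectAffineRoot (p q : ι × ℤ) (x : V) :
    affineValue P (reflectAffineRoot P p q) x = affineValue P q (affineReflection P p x) := by
  rw [affineValue, root_reflectAffineRoot, affineReflection_apply, affineValue, affineValue,
    inner_sub_left, inner_sub_right, inner_smul_right, real_inner_smul_left, ← pairingIn_cast]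
  simp only [reflectAffineRoot]
  push_cast
  ring

theorem affineReflection_reflectAffineRoot (p q : ι × ℤ) :
    affineReflection P (reflectAffineRoot P p q) =
      affineReflection P p * affineReflection P q * affineReflection P p := by
  ext x
  have h1 : ∀ y u, affineReflection P p (y - u) =
      affineReflection P p y - P.coreflection p.1 u := by
    intro y u
    simp only [affineReflection_apply_eq_coreflection, map_sub]
    abel
  rw [affineReflection_apply, affineValue_reflectAffineRoot]
  change _ = affineReflection P p (affineReflection P q (affineReflection P p x))
  rw [affineReflection_apply q, h1, affineReflection_apply_self, map_smul]
  simp only [reflectAffineRoot, P.coroot_reflectionPerm]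

theorem reflectAffineRoot_self (p q : ι × ℤ) :
    reflectAffineRoot P p (reflectAffineRoot P p q) = q := by
  have h : P.pairingIn ℤ (P.reflectionPerm p.1 q.1) p.1 = - P.pairingIn ℤ q.1 p.1 := by
    have : (P.pairingIn ℤ (P.reflectionPerm p.1 q.1) p.1 : ℝ) = - P.pairingIn ℤ q.1 p.1 := by
      rw [pairingIn_cast, pairingIn_cast, inner_root_coroot, inner_root_coroot,
        ← P.pairing_reflectionPerm, P.pairing_reflectionPerm_self_right]
    exact_mod_cast this
  refine Prod.ext (P.reflectionPerm_self _ _) ?_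
  simp only [reflectAffineRoot, h]
  ring

end

/-! ### Simple affine roots, positivity and height -/

section Heights

variable [Finite ι] [P.IsRootSystem] [P.IsCrystallographic] [P.IsReduced] [P.IsIrreducible]
  (b : P.Base)

/-- The simple affine roots: the simple roots and `1 - ξ`. -/
noncomputable def simpleAffineRoot : Option b.support → ι × ℤ
  | none => (P.reflectionPerm (highestRoot b) (highestRoot b), 1)
  | some j => (j, 0)

/-- The coefficients of an affine root with respect to the simple affine roots. -/
noncomputable def affineCoeff (p : ι × ℤ) : Option b.support → ℝ
  | none => p.2
  | some j => b.toWeightBasis.repr (P.root p.1) j + p.2 * mark b j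

/-- The sum of the coefficients with respect to the simple affine roots. -/
noncomputable def affineHeight (p : ι × ℤ) : ℝ := ∑ o, affineCoeff b p o

theorem root_simpleAffineRoot_none :
    P.root (simpleAffineRoot b none).1 = - P.root (highestRoot b) := by
  simp [simpleAffineRoot, P.root_reflectionPerm, P.reflection_apply_self]

theorem repr_le_mark (i : ι) (j : b.support) :
    b.toWeightBasis.repr (P.root i) j ≤ mark b j :=
  (rootLE_iff b _ _).1 (rootLE_highestRoot b i) j

theorem neg_mark_le_repr (i : ι) (j : b.support) :
    - mark b j ≤ b.toWeightBasis.repr (P.root i) j := by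
  have h := repr_le_mark b (P.reflectionPerm i i) j
  rw [P.root_reflectionPerm, P.reflection_apply_self, map_neg, Finsupp.neg_apply] at h
  linarith

theorem one_le_mark (j : b.support) : 1 ≤ mark b j := by
  classical
  have h := repr_le_mark b j j
  rwa [b.toWeightBasis_repr_root, Finsupp.single_eq_same] at h

theorem root_highestRoot_eq_sum : P.root (highestRoot b) = ∑ j, mark b j • P.root j := by
  conv_lhs => rw [← b.toWeightBasis.sum_repr (P.root (highestRoot b))]
  simp [mark]

/-- For `α = ∑ c_j α_j` one has `α + k = k (1 - ξ) + ∑ (c_j + k m_j) α_j`; this is the linear part,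
and `snd_eq_sum_affineCoeff` is the constant part. -/
theorem root_eq_sum_affineCoeff (p : ι × ℤ) :
    P.root p.1 = ∑ o, affineCoeff b p o • P.root (simpleAffineRoot b o).1 := by
  rw [Fintype.sum_option, root_simpleAffineRoot_none, root_highestRoot_eq_sum]
  conv_lhs => rw [← b.toWeightBasis.sum_repr (P.root p.1)]
  simp only [affineCoeff, simpleAffineRoot, add_smul, Finset.sum_add_distrib, mul_smul,
    ← Finset.smul_sum, RootPairing.Base.toWeightBasis_apply]
  module

theorem snd_eq_sum_affineCoeff (p : ι × ℤ) :
    (p.2 : ℝ) = ∑ o, affineCoeff b p o * (simpleAffineRoot b o).2 := by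
  simp [Fintype.sum_option, affineCoeff, simpleAffineRoot]

theorem affineValue_eq_sum (p : ι × ℤ) (x : V) :
    affineValue P p x = ∑ o, affineCoeff b p o * affineValue P (simpleAffineRoot b o) x := by
  simp only [affineValue, mul_add, Finset.sum_add_distrib, ← snd_eq_sum_affineCoeff]
  conv_lhs => rw [root_eq_sum_affineCoeff b p, sum_inner]
  simp only [real_inner_smul_left]

open Classical in
theorem affineCoeff_simpleAffineRoot (o o' : Option b.support) :
    affineCoeff b (simpleAffineRoot b o) o' = if o = o' then 1 else 0 := by
  rcases o with _ | j <;> rcases o' with _ | j'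
  · simp [affineCoeff, simpleAffineRoot]
  · rw [affineCoeff, root_simpleAffineRoot_none]
    simp [simpleAffineRoot, mark]
  · simp [affineCoeff, simpleAffineRoot]
  · simp [affineCoeff, simpleAffineRoot, Finsupp.single_apply]

theorem affineHeight_simpleAffineRoot (o : Option b.support) :
    affineHeight b (simpleAffineRoot b o) = 1 := by
  classical
  simp [affineHeight, affineCoeff_simpleAffineRoot]

theorem affineCoeff_reflectAffineRoot [IsEuclidean P] (p q : ι × ℤ) (o : Option b.support) :
    affineCoeff b (reflectAffineRoot P p q) o =
      affineCoeff b q o - P.pairingIn ℤ q.1 p.1 * affineCoeff b p o := by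
  rcases o with _ | j
  · simp [affineCoeff, reflectAffineRoot]
  · rw [affineCoeff, root_reflectAffineRoot]
    simp only [affineCoeff, reflectAffineRoot, map_sub, map_smul, Finsupp.sub_apply,
      Finsupp.smul_apply, smul_eq_mul]
    push_cast
    ring

theorem affineHeight_reflectAffineRoot [IsEuclidean P] (o : Option b.support) (q : ι × ℤ) :
    affineHeight b (reflectAffineRoot P (simpleAffineRoot b o) q) =
      affineHeight b q - P.pairingIn ℤ q.1 (simpleAffineRoot b o).1 := by
  rw [← mul_one (P.pairingIn ℤ q.1 (simpleAffineRoot b o).1 : ℝ),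
    ← affineHeight_simpleAffineRoot b o]
  simp only [affineHeight, affineCoeff_reflectAffineRoot, Finset.sum_sub_distrib, Finset.mul_sum]

/-- All coefficients of a root lie between `-m_j` and `m_j`, so for `k ≠ 0` every `c_j + k m_j` is
zero or has the sign of `k`. For `k = 0` this is the sign dichotomy for ordinary roots. -/
theorem affineCoeff_sign (p : ι × ℤ) :
    (0 < affineHeight b p ∧ ∀ o, 0 ≤ affineCoeff b p o) ∨
      (affineHeight b p < 0 ∧ ∀ o, affineCoeff b p o ≤ 0) := by
  suffices h : (∃ o, affineCoeff b p o ≠ 0) ∧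
      ((∀ o, 0 ≤ affineCoeff b p o) ∨ (∀ o, affineCoeff b p o ≤ 0)) by
    obtain ⟨⟨o, ho⟩, h | h⟩ := h
    · exact Or.inl ⟨Finset.sum_pos' (fun o _ => h o)
        ⟨o, Finset.mem_univ o, lt_of_le_of_ne (h o) ho.symm⟩, h⟩
    · exact Or.inr ⟨Finset.sum_neg' (fun o _ => h o)
        ⟨o, Finset.mem_univ o, lt_of_le_of_ne (h o) ho⟩, h⟩
  constructor
  · by_contra! h
    refine P.ne_zero p.1 ?_
    rw [root_eq_sum_affineCoeff b p]
    simp [h]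
  · rcases lt_trichotomy p.2 0 with hk | hk | hk
    · right
      have hk' : (p.2 : ℝ) ≤ -1 := by exact_mod_cast Int.le_sub_one_of_lt hk
      rintro (_ | j)
      · simp only [affineCoeff]
        linarith
      · simp only [affineCoeff]
        nlinarith [repr_le_mark b p.1 j, one_le_mark b j]
    · refine (repr_sign b p.1).imp (fun h => ?_) (fun h => ?_) <;>
      · rintro (_ | j)
        · simp [affineCoeff, hk]
        · simpa [affineCoeff, hk] using h j
    · left
      have hk' : (1 : ℝ) ≤ p.2 := by exact_mod_cast hk
      rintro (_ | j)
      · simp only [affineCoeff]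
        linarith
      · simp only [affineCoeff]
        nlinarith [neg_mark_le_repr b p.1 j, one_le_mark b j]

variable {b}

theorem affineCoeff_nonneg {p : ι × ℤ} (hp : 0 < affineHeight b p) (o : Option b.support) :
    0 ≤ affineCoeff b p o := by
  rcases affineCoeff_sign b p with h | h
  · exact h.2 o
  · exact absurd hp h.1.not_gt

theorem affineCoeff_nonpos {p : ι × ℤ} (hp : affineHeight b p < 0) (o : Option b.support) :
    affineCoeff b p o ≤ 0 := by
  rcases affineCoeff_sign b p with h | h
  · exact absurd hp h.1.not_gt
  · exact h.2 o

theorem affineHeight_lt_zero_of_not_pos {p : ι × ℤ} (hp : ¬ 0 < affineHeight b p) :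
    affineHeight b p < 0 := by
  rcases affineCoeff_sign b p with h | h
  · exact absurd h.1 hp
  · exact h.1

/-- The only positive affine root made negative by a simple reflection is the simple one. -/
theorem eq_simpleAffineRoot_of_reflect_neg [IsEuclidean P] {o : Option b.support} {q : ι × ℤ}
    (hq : 0 < affineHeight b q)
    (h : affineHeight b (reflectAffineRoot P (simpleAffineRoot b o) q) < 0) :
    q = simpleAffineRoot b o := by
  classical
  -- The reflection changes only the coefficient at `o`; any other one is nonnegative before,
  -- nonpositive after, and unchanged.
  have h0 : ∀ o', o' ≠ o → affineCoeff b q o' = 0 := by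
    intro o' ho'
    refine le_antisymm ?_ (affineCoeff_nonneg hq o')
    have := affineCoeff_nonpos h o'
    rwa [affineCoeff_reflectAffineRoot, affineCoeff_simpleAffineRoot, if_neg ho'.symm, mul_zero,
      sub_zero] at this
  have hc := affineCoeff_nonneg hq o
  have h1 : P.root q.1 = affineCoeff b q o • P.root (simpleAffineRoot b o).1 := by
    rw [root_eq_sum_affineCoeff b q]
    exact Finset.sum_eq_single o (fun o' _ ho' => by rw [h0 o' ho', zero_smul]) (by simp)
  have h2 : (q.2 : ℝ) = affineCoeff b q o * (simpleAffineRoot b o).2 := by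
    rw [snd_eq_sum_affineCoeff b q]
    exact Finset.sum_eq_single o (fun o' _ ho' => by rw [h0 o' ho', zero_mul]) (by simp)
  have hne := P.ne_zero (simpleAffineRoot b o).1
  have hdep : ¬ LinearIndependent ℝ ![P.root q.1, P.root (simpleAffineRoot b o).1] := by
    rw [LinearIndependent.pair_iff]
    intro h'
    have := h' 1 (-affineCoeff b q o) (by rw [h1]; module)
    exact one_ne_zero this.1
  -- Reducedness leaves the multiples `1` and `-1`; the second contradicts `hc`.
  rcases RootPairing.IsReduced.eq_or_eq_neg _ _ hdep with h3 | h3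
  · have h4 : affineCoeff b q o = 1 := by
      have : (affineCoeff b q o - 1) • P.root (simpleAffineRoot b o).1 = 0 := by
        rw [sub_smul, ← h1, h3, one_smul, sub_self]
      exact sub_eq_zero.1 ((smul_eq_zero.1 this).resolve_right hne)
    refine Prod.ext (P.root.injective h3) ?_
    rw [h4, one_mul] at h2
    exact_mod_cast h2
  · have : (affineCoeff b q o + 1) • P.root (simpleAffineRoot b o).1 = 0 := by
      rw [add_smul, ← h1, h3, one_smul, neg_add_cancel]
    have := (smul_eq_zero.1 this).resolve_right hne
    linarith

/-- Here `q` is the negative of the simple affine root, so both define the same hyperplane. -/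
theorem affineReflection_eq_of_reflect_pos [IsEuclidean P] {o : Option b.support} {q : ι × ℤ}
    (hq : affineHeight b q < 0)
    (h : 0 < affineHeight b (reflectAffineRoot P (simpleAffineRoot b o) q)) :
    affineReflection P q = affineReflection P (simpleAffineRoot b o) := by
  have h1 := eq_simpleAffineRoot_of_reflect_neg h (by rwa [reflectAffineRoot_self])
  have h2 := affineReflection_reflectAffineRoot (P := P) (simpleAffineRoot b o)
    (reflectAffineRoot P (simpleAffineRoot b o) q)
  rw [reflectAffineRoot_self, h1] at h2
  rw [h2, affineReflection_mul_self, one_mul]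

/-! ### Words in simple reflections and the exchange property -/

variable (b)

/-- The product of the simple affine reflections in a word. -/
noncomputable def reflectionWord (l : List (Option b.support)) : V ≃ᵃ[ℝ] V :=
  (l.map fun o => affineReflection P (simpleAffineRoot b o)).prod

theorem reflectionWord_cons (o : Option b.support) (l : List (Option b.support)) :
    reflectionWord b (o :: l) = affineReflection P (simpleAffineRoot b o) * reflectionWord b l := by
  simp [reflectionWord]

/-- The exchange property: a negative affine root stays negative along a word, or its reflection
shortens the word. -/
theorem exchange [IsEuclidean P] (l : List (Option b.support)) (q : ι × ℤ)
    (hq : affineHeight b q < 0) :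
    (∃ p, affineHeight b p < 0 ∧ ∀ x, affineValue P q (reflectionWord b l x) = affineValue P p x) ∨
      ∃ l' : List (Option b.support), l'.length + 1 = l.length ∧
        affineReflection P q * reflectionWord b l = reflectionWord b l' := by
  induction l generalizing q with
  | nil => exact Or.inl ⟨q, hq, fun x => rfl⟩
  | cons o l ih =>
    by_cases h : 0 < affineHeight b (reflectAffineRoot P (simpleAffineRoot b o) q)
    -- The sign changes at the letter `o`, so the reflection in `q` is that letter and cancels it.
    · refine Or.inr ⟨l, rfl, ?_⟩
      rw [affineReflection_eq_of_reflect_pos hq h, reflectionWord_cons, ← mul_assoc,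
        affineReflection_mul_self, one_mul]
    -- Otherwise the reflected root is still negative and is pushed through the rest of the word.
    · rcases ih _ (affineHeight_lt_zero_of_not_pos h) with ⟨p, hp, hpx⟩ | ⟨l', hl', hl⟩
      · refine Or.inl ⟨p, hp, fun x => ?_⟩
        rw [← hpx, affineValue_reflectAffineRoot, reflectionWord_cons]
        rfl
      · refine Or.inr ⟨o :: l', by simp [hl'], ?_⟩
        rw [reflectionWord_cons, reflectionWord_cons, ← hl, affineReflection_reflectAffineRoot]
        simp only [← mul_assoc, affineReflection_mul_self, one_mul]

theorem affineValue_nonpos_of_neg {q : ι × ℤ} (hq : affineHeight b q < 0) {a : V}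
    (ha : ∀ o, 0 ≤ affineValue P (simpleAffineRoot b o) a) : affineValue P q a ≤ 0 := by
  rw [affineValue_eq_sum b]
  exact Finset.sum_nonpos fun o _ =>
    mul_nonpos_of_nonpos_of_nonneg (affineCoeff_nonpos hq o) (ha o)

/-- Apply `exchange` to the tail of the word and the negative of its first simple root. Either the
word shortens by two letters, or that simple root is both nonpositive and nonnegative at the image
point; then the first reflection fixes the image and can be dropped. -/
theorem reflectionWord_eq_of_mem [IsEuclidean P] (n : ℕ) (l : List (Option b.support))
    (hl : l.length ≤ n) {a : V} (ha : ∀ o, 0 ≤ affineValue P (simpleAffineRoot b o) a)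
    (hla : ∀ o, 0 ≤ affineValue P (simpleAffineRoot b o) (reflectionWord b l a)) :
    reflectionWord b l a = a := by
  induction n generalizing l with
  | zero =>
    rw [List.eq_nil_of_length_eq_zero (Nat.le_zero.1 hl)]
    rfl
  | succ n ih =>
    rcases l with _ | ⟨o, l⟩
    · rfl
    simp only [List.length_cons, add_le_add_iff_right] at hl
    let q := reflectAffineRoot P (simpleAffineRoot b o) (simpleAffineRoot b o)
    have hq : affineHeight b q < 0 := by
      have h2 : (P.pairingIn ℤ (simpleAffineRoot b o).1 (simpleAffineRoot b o).1 : ℝ) = 2 := by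
        rw [pairingIn_cast, inner_root_coroot, P.pairing_same]
      rw [affineHeight_reflectAffineRoot, affineHeight_simpleAffineRoot, h2]
      norm_num
    rcases exchange b l q hq with ⟨p, hp, hpx⟩ | ⟨l', hl', hll⟩
    · have h1 : affineValue P (simpleAffineRoot b o) (reflectionWord b (o :: l) a) ≤ 0 := by
        have h2 := affineValue_nonpos_of_neg b hp ha
        rwa [← hpx, affineValue_reflectAffineRoot] at h2
      have h2 := le_antisymm h1 (hla o)
      have h3 : reflectionWord b (o :: l) a = reflectionWord b l a := by
        have h4 := affineReflection_apply (P := P) (simpleAffineRoot b o) (reflectionWord b (o :: l) a)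
        rw [h2, zero_smul, sub_zero] at h4
        rw [← h4, reflectionWord_cons]
        exact affineReflection_apply_self _ _
      rw [h3] at hla ⊢
      exact ih l hl hla
    · have h1 : reflectionWord b (o :: l) = reflectionWord b l' := by
        rw [reflectionWord_cons, ← hll, affineReflection_reflectAffineRoot,
          affineReflection_mul_self, one_mul]
      rw [h1] at hla ⊢
      exact ih l' (by omega) hla

/-! ### Generation of the affine Weyl group by simple reflections -/

/-- The group generated by the simple affine reflections. -/
noncomputable def simpleAffineGroup : Subgroup (V ≃ᵃ[ℝ] V) :=
  Subgroup.closure (Set.range fun o => affineReflection P (simpleAffineRoot b o))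

theorem affineReflection_simple_mem (o : Option b.support) :
    affineReflection P (simpleAffineRoot b o) ∈ simpleAffineGroup b :=
  Subgroup.subset_closure ⟨o, rfl⟩

theorem exists_reflectionWord [IsEuclidean P] {g : V ≃ᵃ[ℝ] V} (hg : g ∈ simpleAffineGroup b) :
    ∃ l, reflectionWord b l = g := by
  induction hg using Subgroup.closure_induction'' with
  | mem g hg =>
    obtain ⟨o, rfl⟩ := hg
    exact ⟨[o], by simp [reflectionWord]⟩
  | inv_mem g hg =>
    obtain ⟨o, rfl⟩ := hg
    exact ⟨[o], by simp [reflectionWord, affineReflection_inv]⟩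
  | one => exact ⟨[], rfl⟩
  | mul g h _ _ hg hh =>
    obtain ⟨l, rfl⟩ := hg
    obtain ⟨l', rfl⟩ := hh
    exact ⟨l ++ l', by simp [reflectionWord]⟩

/-- Otherwise expanding one factor of `⟪α, α⟫` in simple affine roots, with nonnegative
coefficients, would give `⟪α, α⟫ ≤ 0`. -/
theorem exists_simple_pairingIn_pos [IsEuclidean P] {p : ι × ℤ} (hp : 0 < affineHeight b p) :
    ∃ o, 0 < P.pairingIn ℤ p.1 (simpleAffineRoot b o).1 := by
  by_contra! h
  have h1 : ∀ o, ⟪P.root p.1, P.root (simpleAffineRoot b o).1⟫ ≤ 0 := by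
    intro o
    have h2 : (P.pairingIn ℤ p.1 (simpleAffineRoot b o).1 : ℝ) ≤ 0 := by exact_mod_cast h o
    rw [pairingIn_cast, IsEuclidean.coroot_eq, real_inner_smul_right] at h2
    have h3 := real_inner_self_pos.2 (P.ne_zero (simpleAffineRoot b o).1)
    by_contra! h4
    exact absurd h2 (not_le.2 (by positivity))
  have h2 : ⟪P.root p.1, P.root p.1⟫ ≤ 0 := by
    conv_lhs => rw [root_eq_sum_affineCoeff b p]
    rw [sum_inner]
    refine Finset.sum_nonpos fun o _ => ?_
    rw [real_inner_smul_left, real_inner_comm, ← root_eq_sum_affineCoeff b p]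
    exact mul_nonpos_of_nonneg_of_nonpos (affineCoeff_nonneg hp o) (h1 o)
  exact absurd h2 (not_le.2 (real_inner_self_pos.2 (P.ne_zero p.1)))

/-- Descent on height: a simple reflection with positive pairing lowers the height by at least 1 and
conjugates the reflections, unless the root is already simple. -/
theorem affineReflection_mem [IsEuclidean P] {p : ι × ℤ} (hp : 0 < affineHeight b p) :
    affineReflection P p ∈ simpleAffineGroup b := by
  obtain ⟨n, hn⟩ := exists_nat_ge (affineHeight b p)
  induction n generalizing p with
  | zero => exact absurd hp (not_lt.2 (by simpa using hn))
  | succ n ih =>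
    obtain ⟨o, ho⟩ := exists_simple_pairingIn_pos b hp
    by_cases h : 0 < affineHeight b (reflectAffineRoot P (simpleAffineRoot b o) p)
    · have ho' : (1 : ℝ) ≤ P.pairingIn ℤ p.1 (simpleAffineRoot b o).1 := by exact_mod_cast ho
      have h1 := ih h (by
        rw [affineHeight_reflectAffineRoot]
        push_cast at hn
        linarith)
      have hs := affineReflection_simple_mem b o
      have h2 := mul_mem (mul_mem hs h1) hs
      rwa [affineReflection_reflectAffineRoot, ← mul_assoc, ← mul_assoc,
        affineReflection_mul_self, one_mul, mul_assoc, affineReflection_mul_self, mul_one] at h2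
    · rw [eq_simpleAffineRoot_of_reflect_neg hp (affineHeight_lt_zero_of_not_pos h)]
      exact affineReflection_simple_mem b o

theorem affineHeight_pos_of_snd_pos {p : ι × ℤ} (hp : 0 < p.2) : 0 < affineHeight b p := by
  by_contra h
  have h1 := affineCoeff_nonpos (affineHeight_lt_zero_of_not_pos h) none
  have h2 : (0 : ℝ) < p.2 := by exact_mod_cast hp
  exact absurd h1 (not_le.2 h2)

theorem constVAdd_mem [IsEuclidean P] {q : V} (hq : q ∈ P.corootSpan ℤ) :
    AffineEquiv.constVAdd ℝ V q ∈ simpleAffineGroup b := by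
  let A : AddSubgroup V :=
    { carrier := {x | AffineEquiv.constVAdd ℝ V x ∈ simpleAffineGroup b}
      zero_mem' := by
        change AffineEquiv.constVAdd ℝ V 0 ∈ simpleAffineGroup b
        rw [AffineEquiv.constVAdd_zero]
        exact one_mem _
      add_mem' := fun {x y} hx hy => by
        change AffineEquiv.constVAdd ℝ V (x + y) ∈ simpleAffineGroup b
        rw [AffineEquiv.constVAdd_add]
        exact mul_mem hx hy
      neg_mem' := fun {x} hx => by
        change AffineEquiv.constVAdd ℝ V (-x) ∈ simpleAffineGroup b
        rw [← AffineEquiv.constVAdd_symm]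
        exact inv_mem hx }
  have h : P.corootSpan ℤ ≤ AddSubgroup.toIntSubmodule A := by
    refine Submodule.span_le.2 ?_
    rintro _ ⟨i, rfl⟩
    change AffineEquiv.constVAdd ℝ V (P.coroot i) ∈ simpleAffineGroup b
    -- Translation by `α^∨` is a product of reflections in two consecutive parallel hyperplanes.
    -- Levels 1 and 2 make both affine roots positive whatever the sign of `α`.
    have h1 := affineReflection_mem b (affineHeight_pos_of_snd_pos b (p := (i, 1)) one_pos)
    have h2 := affineReflection_mem b (affineHeight_pos_of_snd_pos b (p := (i, 2)) two_pos)
    convert mul_mem h1 h2 using 1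
    ext x
    change P.coroot i + x = affineReflection P (i, 1) (affineReflection P (i, 2) x)
    simp only [affineReflection_apply_eq_coreflection, map_sub, map_smul,
      P.coreflection_apply_self, P.coreflection_same]
    push_cast
    module
  exact h hq

theorem toAffineEquiv_mem [IsEuclidean P] {w : V ≃ₗ[ℝ] V} (hw : w ∈ weylGroup b) :
    w.toAffineEquiv ∈ simpleAffineGroup b := by
  have key : ∀ i ∈ b.support, (P.coreflection i).toAffineEquiv ∈ simpleAffineGroup b := by
    intro i hi
    convert affineReflection_simple_mem b (some ⟨i, hi⟩) using 1
    ext x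
    simp [affineReflection_apply_eq_coreflection, simpleAffineRoot]
  induction hw using Subgroup.closure_induction'' with
  | mem w hw => obtain ⟨i, hi, rfl⟩ := hw; exact key i hi
  | inv_mem w hw =>
    obtain ⟨i, hi, rfl⟩ := hw
    rw [P.coreflection_inv]
    exact key i hi
  | one => exact one_mem _
  | mul v w _ _ hv hw => exact mul_mem hv hw

theorem affineWeylGroup_le [IsEuclidean P] : affineWeylGroup b ≤ simpleAffineGroup b := by
  intro g hg
  have h := mul_mem (constVAdd_mem b hg.2) (toAffineEquiv_mem b hg.1)
  convert h using 1
  ext a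
  rw [affineEquiv_apply g a, add_comm]
  rfl

end Heights

end AffineRoots

section Alcoves

variable {ι V : Type*} [NormedAddCommGroup V] [InnerProductSpace ℝ V] {P : RootPairing ι ℝ V V}

/-! ### Root and coweight lattices; the Weyl group -/

section Lattices

variable [IsEuclidean P] [P.IsRootSystem] (b : P.Base)

theorem inner_fundamentalCoweight [DecidableEq ι] (i j : b.support) :
    ⟪P.root i, fundamentalCoweight b j⟫ = if i = j then 1 else 0 := by
  rw [← IsEuclidean.toLinearMap_eq (P := P), root_fundamentalCoweight]

theorem eq_of_inner_root_eq {x y : V} (h : ∀ j : b.support, ⟪P.root j, x⟫ = ⟪P.root j, y⟫) :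
    x = y := by
  refine ext_inner_left ℝ fun v => ?_
  rw [← b.toWeightBasis.sum_repr v, sum_inner, sum_inner]
  simp [real_inner_smul_left, h]

theorem eq_sum_fundamentalCoweight (x : V) :
    x = ∑ j : b.support, ⟪P.root j, x⟫ • fundamentalCoweight b j := by
  classical
  refine eq_of_inner_root_eq b fun i => ?_
  simp [inner_sum, real_inner_smul_right, inner_fundamentalCoweight]

theorem mem_coweightLattice_iff (x : V) :
    x ∈ coweightLattice b ↔ ∀ j : b.support, ∃ k : ℤ, ⟪P.root j, x⟫ = k := by
  simp [coweightLattice, IsEuclidean.toLinearMap_eq]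

theorem corootSpan_le_coweightLattice [P.IsCrystallographic] :
    (P.corootSpan ℤ).toAddSubgroup ≤ coweightLattice b := by
  have h : P.corootSpan ℤ ≤ AddSubgroup.toIntSubmodule (coweightLattice b) := by
    refine Submodule.span_le.2 ?_
    rintro _ ⟨i, rfl⟩
    exact (mem_coweightLattice_iff b _).2 fun j => ⟨_, (pairingIn_cast (j : ι) i).symm⟩
  exact h

theorem inner_rootSpan_coweightLattice {x : V} (hx : x ∈ coweightLattice b) {q : V}
    (hq : q ∈ P.rootSpan ℤ) : ∃ n : ℤ, ⟪x, q⟫ = n := by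
  rw [RootPairing.rootSpan, ← b.span_int_root_support] at hq
  induction hq using Submodule.span_induction with
  | mem y hy =>
    obtain ⟨i, hi, rfl⟩ := hy
    obtain ⟨k, hk⟩ := (mem_coweightLattice_iff b x).1 hx ⟨i, hi⟩
    exact ⟨k, by rw [real_inner_comm, hk]⟩
  | zero => exact ⟨0, by simp⟩
  | add y z _ _ hy hz =>
    obtain ⟨k, hk⟩ := hy
    obtain ⟨l, hl⟩ := hz
    exact ⟨k + l, by rw [inner_add_right, hk, hl]; push_cast; rfl⟩
  | smul c y _ hy =>
    obtain ⟨k, hk⟩ := hy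
    exact ⟨c * k, by rw [← Int.cast_smul_eq_zsmul ℝ, inner_smul_right, hk]; push_cast; rfl⟩

/-- Pairing with `ω_j^∨ ∈ P^∨` reads off the coefficient of `α_j`. -/
theorem mem_rootSpan_of_inner (v : V)
    (h : ∀ y ∈ coweightLattice b, ∃ n : ℤ, ⟪y, v⟫ = n) : v ∈ P.rootSpan ℤ := by
  classical
  have hj : ∀ j : b.support, ∃ n : ℤ, b.toWeightBasis.repr v j = n := by
    intro j
    obtain ⟨n, hn⟩ := h (fundamentalCoweight b j) ((mem_coweightLattice_iff b _).2 fun i => by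
      rw [inner_fundamentalCoweight]
      split_ifs
      · exact ⟨1, by simp⟩
      · exact ⟨0, by simp⟩)
    refine ⟨n, ?_⟩
    rw [← hn, real_inner_comm]
    conv_rhs => rw [← b.toWeightBasis.sum_repr v]
    simp only [sum_inner, real_inner_smul_left, RootPairing.Base.toWeightBasis_apply,
      inner_fundamentalCoweight]
    simp
  choose n hn using hj
  rw [← b.toWeightBasis.sum_repr v]
  refine sum_mem fun j _ => ?_
  rw [hn, Int.cast_smul_eq_zsmul, RootPairing.Base.toWeightBasis_apply]
  exact Submodule.smul_mem _ _ (Submodule.subset_span ⟨_, rfl⟩)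

/-- A shifted coweight lattice has finitely many points with bounded coordinates. -/
theorem finite_shiftedLattice_inter {M : ℕ} (hM : 0 < M) (v : V) (C : ℝ) :
    (shiftedLattice M (coweightLattice b) v ∩
      {a | ∀ j : b.support, |⟪P.root j, a⟫| ≤ C}).Finite := by
  classical
  have hM' : (M : ℝ) ≠ 0 := by positivity
  -- The integral coordinates of `M a - v`; on the shifted lattice the floor is exact (`hf`).
  let f : V → b.support → ℤ := fun a j => ⌊M * ⟪P.root j, a⟫ - ⟪P.root j, v⟫⌋
  let B : b.support → ℤ := fun j => ⌈M * C + |⟪P.root j, v⟫|⌉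
  have hf : ∀ a ∈ shiftedLattice M (coweightLattice b) v, ∀ j,
      (f a j : ℝ) = M * ⟪P.root j, a⟫ - ⟪P.root j, v⟫ := by
    rintro _ ⟨x, hx, rfl⟩ j
    obtain ⟨k, hk⟩ := (mem_coweightLattice_iff b x).1 hx j
    have h1 : (M : ℝ) * ⟪P.root j, (1 / (M : ℝ)) • (v + x)⟫ - ⟪P.root j, v⟫ = k := by
      rw [inner_smul_right, inner_add_right, hk]
      field_simp
      ring
    simp only [f, h1, Int.floor_intCast]
  refine Set.Finite.of_injOn (f := f) (t := Set.Icc (-B) B) ?_ ?_ (Set.finite_Icc _ _)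
  · rintro a ⟨ha, hC⟩
    have h1 : ∀ j, |(f a j : ℝ)| ≤ B j := fun j => by
      rw [hf a ha]
      refine (abs_sub _ _).trans (le_trans ?_ (Int.le_ceil _))
      rw [abs_mul, abs_of_nonneg (Nat.cast_nonneg M)]
      gcongr
      exact hC j
    refine ⟨fun j => ?_, fun j => ?_⟩
    · have := (abs_le.1 (h1 j)).1
      exact_mod_cast this
    · have := (abs_le.1 (h1 j)).2
      exact_mod_cast this
  · rintro a ⟨ha, -⟩ a' ⟨ha', -⟩ h
    refine eq_of_inner_root_eq b fun j => ?_
    have h1 := hf a ha j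
    rw [h, hf a' ha' j] at h1
    have h2 : (M : ℝ) * ⟪P.root j, a⟫ = M * ⟪P.root j, a'⟫ := by linarith
    exact mul_left_cancel₀ hM' h2

end Lattices

theorem inner_weylGroup [IsEuclidean P] (b : P.Base) : ∀ w ∈ weylGroup b, ∀ x y : V,
    ⟪w x, w y⟫ = ⟪x, y⟫ := by
  have key : ∀ i, ∀ x y, ⟪P.coreflection i x, P.coreflection i y⟫ = ⟪x, y⟫ := by
    intro i x y
    have h := real_inner_self_pos.2 (P.ne_zero i)
    rw [coreflection_apply_inner, coreflection_apply_inner, IsEuclidean.coroot_eq]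
    simp only [inner_sub_left, inner_sub_right, real_inner_smul_left, real_inner_smul_right,
      real_inner_comm (P.root i) x]
    field_simp
    ring
  intro w hw
  induction hw using Subgroup.closure_induction'' with
  | mem w hw => obtain ⟨i, -, rfl⟩ := hw; exact key i
  | inv_mem w hw =>
    obtain ⟨i, -, rfl⟩ := hw
    rw [P.coreflection_inv]
    exact key i
  | one => exact fun x y => rfl
  | mul v w _ _ hv hw => exact fun x y => (hv _ _).trans (hw x y)

/-- Weyl group elements permute the finitely many coroots, which span `V`. -/
theorem finite_weylGroup [Finite ι] [P.IsRootSystem] (b : P.Base) : Finite (weylGroup b) := by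
  have h : ∀ w ∈ weylGroup b, ∀ i, w (P.coroot i) ∈ Set.range P.coroot := by
    intro w hw
    induction hw using Subgroup.closure_induction'' with
    | mem w hw =>
      obtain ⟨j, -, rfl⟩ := hw
      exact fun i => ⟨_, P.coroot_reflectionPerm j i⟩
    | inv_mem w hw =>
      obtain ⟨j, -, rfl⟩ := hw
      rw [P.coreflection_inv]
      exact fun i => ⟨_, P.coroot_reflectionPerm j i⟩
    | one => exact fun i => ⟨i, rfl⟩
    | mul v w _ _ hv hw =>
      intro i
      obtain ⟨j, hj⟩ := hw i
      obtain ⟨k, hk⟩ := hv j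
      exact ⟨k, by rw [hk, hj]; rfl⟩
  refine Finite.of_injective (fun (w : weylGroup b) (i : ι) =>
    (⟨w.1 (P.coroot i), h w.1 w.2 i⟩ : Set.range P.coroot)) fun w w' hww => ?_
  refine Subtype.ext (LinearEquiv.toLinearMap_injective ?_)
  refine LinearMap.ext_on_range (RootPairing.IsRootSystem.span_coroot_eq_top (P := P)) fun i => ?_
  exact congrArg Subtype.val (congrFun hww i)

/-- Every root is reached from simple ones by simple reflections and negation, which conjugate or
preserve its reflection. -/
theorem coreflection_mem_weylGroup [Finite ι] [P.IsRootSystem] [P.IsCrystallographic]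
    [P.IsReduced] (b : P.Base) (i : ι) : P.coreflection i ∈ weylGroup b := by
  refine b.induction_reflect i (p := fun i => P.coreflection i ∈ weylGroup b) (fun i hi => ?_)
    (fun i hi => Subgroup.subset_closure ⟨i, hi, rfl⟩) fun i j hi hj => ?_
  · have : P.coreflection (P.reflectionPerm i i) = P.coreflection i := by
      rw [P.coreflection_eq_flip_reflection, P.coreflection_eq_flip_reflection]
      change P.flip.reflection (P.flip.reflectionPerm i i) = _
      rw [P.flip.reflection_reflectionPerm, ← sq, P.flip.reflection_sq, one_mul]
    rwa [this]
  · have hj' : P.coreflection j ∈ weylGroup b := Subgroup.subset_closure ⟨j, hj, rfl⟩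
    have : P.coreflection (P.reflectionPerm j i) =
        P.coreflection j * P.coreflection i * P.coreflection j := by
      simp only [P.coreflection_eq_flip_reflection]
      exact P.flip.reflection_reflectionPerm
    rw [this]
    exact mul_mem (mul_mem hj' hi) hj'

/-! ### The alcove as a strict fundamental domain -/

section FundamentalDomain

variable [Finite ι] [IsEuclidean P] [P.IsRootSystem] [P.IsCrystallographic] [P.IsReduced]
  [P.IsIrreducible] (b : P.Base)

theorem affineReflection_mem_affineWeylGroup (p : ι × ℤ) :
    affineReflection P p ∈ affineWeylGroup b := by
  refine ⟨coreflection_mem_weylGroup b p.1, ?_⟩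
  rw [affineReflection_apply_eq_coreflection, map_zero, zero_sub, Int.cast_smul_eq_zsmul]
  exact neg_mem (Submodule.smul_mem _ _ (Submodule.subset_span ⟨p.1, rfl⟩))

theorem affineValue_simple_some (j : b.support) (x : V) :
    affineValue P (simpleAffineRoot b (some j)) x = ⟪P.root j, x⟫ := by
  simp [affineValue, simpleAffineRoot]

theorem affineValue_simple_none (x : V) : affineValue P (simpleAffineRoot b none) x =
    1 - ∑ j : b.support, ⟪P.root j, x⟫ * mark b j := by
  rw [affineValue, root_simpleAffineRoot_none, root_highestRoot_eq_sum, inner_neg_left, sum_inner]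
  simp [simpleAffineRoot, real_inner_smul_left, mul_comm]
  ring

/-- The coordinates `y_j = ⟪α_j, a⟫` and `y_0 = 1 - ⟪ξ, a⟫` are the values of the simple affine
roots. -/
theorem mem_fundamentalDomain_iff (a : V) :
    a ∈ fundamentalDomain b ↔ ∀ o, 0 ≤ affineValue P (simpleAffineRoot b o) a := by
  classical
  constructor
  · rintro ⟨y₀, y, h0, hy, hsum, rfl⟩
    have h1 : ∀ i : b.support, ⟪P.root i, ∑ j, y j • fundamentalCoweight b j⟫ = y i := by
      intro i
      simp [inner_sum, real_inner_smul_right, inner_fundamentalCoweight]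
    rintro (_ | j)
    · rw [affineValue_simple_none]
      simp only [h1]
      linarith
    · rw [affineValue_simple_some, h1]
      exact hy j
  · intro h
    refine ⟨affineValue P (simpleAffineRoot b none) a, fun j => ⟪P.root j, a⟫, h none,
      fun j => ?_, ?_, eq_sum_fundamentalCoweight b a⟩
    · simpa only [affineValue_simple_some] using h (some j)
    · rw [affineValue_simple_none]
      ring

theorem abs_inner_le_one_of_mem {a : V} (ha : a ∈ fundamentalDomain b) (j : b.support) :
    |⟪P.root j, a⟫| ≤ 1 := by
  rw [mem_fundamentalDomain_iff] at ha
  have h0 : ∀ j : b.support, 0 ≤ ⟪P.root j, a⟫ := fun j => by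
    simpa only [affineValue_simple_some] using ha (some j)
  have h1 := ha none
  rw [affineValue_simple_none] at h1
  rw [abs_of_nonneg (h0 j)]
  have h2 : ⟪P.root j, a⟫ * mark b j ≤ ∑ j : b.support, ⟪P.root j, a⟫ * mark b j :=
    Finset.single_le_sum (f := fun j : b.support => ⟪P.root j, a⟫ * mark b j)
      (fun i _ => mul_nonneg (h0 i) (zero_le_one.trans (one_le_mark b i))) (Finset.mem_univ j)
  nlinarith [h0 j, one_le_mark b j]

theorem finite_shiftedLattice_inter_fundamentalDomain {M : ℕ} (hM : 0 < M) (v : V) :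
    (shiftedLattice M (coweightLattice b) v ∩ fundamentalDomain b).Finite :=
  (finite_shiftedLattice_inter b hM v 1).subset
    (Set.inter_subset_inter_right _ fun _ ha j => abs_inner_le_one_of_mem b ha j)

/-- The open alcove is nonempty. -/
theorem exists_interior_point : ∃ c : V, ∀ o, 0 < affineValue P (simpleAffineRoot b o) c := by
  classical
  have hH : 0 ≤ ∑ j, mark b j :=
    Finset.sum_nonneg fun j _ => zero_le_one.trans (one_le_mark b j)
  -- Chosen so that all coordinates, including `y_0 = 1 - ε ∑ m_j`, equal `ε`.
  let ε : ℝ := 1 / (∑ j, mark b j + 1)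
  have hε : 0 < ε := by positivity
  have h1 : ∀ i : b.support, ⟪P.root i, ∑ j, ε • fundamentalCoweight b j⟫ = ε := by
    intro i
    simp [inner_sum, real_inner_smul_right, inner_fundamentalCoweight]
  refine ⟨∑ j, ε • fundamentalCoweight b j, ?_⟩
  rintro (_ | j)
  · rw [affineValue_simple_none]
    simp only [h1, ← Finset.mul_sum]
    have h2 : ε * (∑ j, mark b j + 1) = 1 := by
      simp only [ε]
      field_simp
    linarith
  · rwa [affineValue_simple_some, h1]

/-- Reflecting a point in a hyperplane that separates it from `c` moves it closer to `c`. -/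
theorem norm_affineReflection_sub_lt {p : ι × ℤ} {c y : V} (hc : 0 < affineValue P p c)
    (hy : affineValue P p y < 0) : ‖affineReflection P p y - c‖ < ‖y - c‖ := by
  refine lt_of_pow_lt_pow_left₀ 2 (norm_nonneg _) ?_
  have hr := real_inner_self_pos.2 (P.ne_zero p.1)
  have h1 : ⟪P.root p.1, y - c⟫ = affineValue P p y - affineValue P p c := by
    simp only [affineValue, inner_sub_right]
    ring
  have h2 : affineReflection P p y - c =
      (y - c) - (affineValue P p y * (2 / ⟪P.root p.1, P.root p.1⟫)) • P.root p.1 := by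
    rw [affineReflection_apply, IsEuclidean.coroot_eq, smul_smul]
    abel
  have h3 : ‖affineReflection P p y - c‖ ^ 2 = ‖y - c‖ ^ 2 +
      4 * (affineValue P p y * affineValue P p c) / ⟪P.root p.1, P.root p.1⟫ := by
    rw [h2, norm_sub_sq_real, real_inner_smul_right, real_inner_comm (P.root p.1) (y - c), h1, norm_smul, mul_pow,
      ← real_inner_self_eq_norm_sq (P.root p.1), Real.norm_eq_abs, sq_abs]
    field_simp
    ring
  rw [h3]
  have h4 : 4 * (affineValue P p y * affineValue P p c) / ⟪P.root p.1, P.root p.1⟫ < 0 :=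
    div_neg_of_neg_of_pos (by nlinarith [mul_neg_of_neg_of_pos hy hc]) hr
  linarith

/-- The orbit lies in the finitely many shifted lattices `w a + P^∨`, each with finitely many points
in a bounded region. -/
theorem finite_orbit_inter_closedBall (a c : V) (R : ℝ) :
    ({y | ∃ g ∈ affineWeylGroup b, y = g a} ∩ {y | ‖y - c‖ ≤ R}).Finite := by
  have := finite_weylGroup b
  let C : ℝ := (∑ j : b.support, ‖P.root j‖) * (R + ‖c‖)
  refine (Set.finite_iUnion fun w : weylGroup b =>
    finite_shiftedLattice_inter b one_pos (w.1 a) C).subset ?_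
  rintro _ ⟨⟨g, hg, rfl⟩, hR⟩
  refine Set.mem_iUnion.2 ⟨⟨g.linear, hg.1⟩, ⟨g 0, corootSpan_le_coweightLattice b hg.2, ?_⟩,
    fun j => ?_⟩
  · rw [affineEquiv_apply g a]
    simp
  · have h1 : ‖g a‖ ≤ R + ‖c‖ := by
      have := norm_le_norm_sub_add (g a) c
      have hR' : ‖g a - c‖ ≤ R := hR
      linarith
    refine (abs_real_inner_le_norm _ _).trans ?_
    refine mul_le_mul ?_ h1 (norm_nonneg _) (Finset.sum_nonneg fun _ _ => norm_nonneg _)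
    exact Finset.single_le_sum (f := fun j : b.support => ‖P.root j‖)
      (fun _ _ => norm_nonneg _) (Finset.mem_univ j)

/-- The closed fundamental alcove is a strict fundamental domain of the affine Weyl group. -/
theorem isStrictFundamentalDomain :
    IsStrictFundamentalDomain (affineWeylGroup b) (fundamentalDomain b) := by
  constructor
  · intro a
    obtain ⟨c, hc⟩ := exists_interior_point b
    -- A point of the orbit nearest to `c`; restricting to the ball through `a` makes the search
    -- finite.
    obtain ⟨y, ⟨⟨g, hg, rfl⟩, hyR⟩, hmin⟩ := Set.exists_min_image _ (fun y => ‖y - c‖)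
      (finite_orbit_inter_closedBall b a c ‖a - c‖)
      ⟨a, ⟨1, one_mem _, rfl⟩, (le_refl ‖a - c‖)⟩
    refine ⟨g, hg, (mem_fundamentalDomain_iff b _).2 fun o => ?_⟩
    by_contra! h
    have h1 := norm_affineReflection_sub_lt (hc o) h
    have hyR' : ‖g a - c‖ ≤ ‖a - c‖ := hyR
    exact absurd (hmin _ ⟨⟨_, mul_mem (affineReflection_mem_affineWeylGroup b _) hg, rfl⟩,
      h1.le.trans hyR'⟩) (not_le.2 h1)
  · intro g hg a ha hga
    obtain ⟨l, rfl⟩ := exists_reflectionWord b (affineWeylGroup_le b hg)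
    rw [mem_fundamentalDomain_iff] at ha hga
    exact reflectionWord_eq_of_mem b _ l le_rfl ha hga

end FundamentalDomain

/-! ### Duality, admissible shifts and the two sides of the theorem -/

/-- The dual root system of a Euclidean root system is Euclidean. -/
instance IsEuclidean.flip [IsEuclidean P] : IsEuclidean P.flip where
  toLinearMap_eq x y := by
    change P.toLinearMap y x = _
    rw [IsEuclidean.toLinearMap_eq, real_inner_comm]
  coroot_eq i := by
    change P.root i = (2 / ⟪P.coroot i, P.coroot i⟫) • P.coroot i
    have h := real_inner_self_pos.2 (P.ne_zero i)
    rw [IsEuclidean.coroot_eq, real_inner_smul_left, real_inner_smul_right, smul_smul]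
    rw [show 2 / (2 / ⟪P.root i, P.root i⟫ * (2 / ⟪P.root i, P.root i⟫ * ⟪P.root i, P.root i⟫)) *
      (2 / ⟪P.root i, P.root i⟫) = 1 by field_simp, one_smul]

theorem weylGroup_flip [IsEuclidean P] (b : P.Base) : weylGroup b.flip = weylGroup b := by
  refine congrArg Subgroup.closure (Set.image_congr fun i _ => ?_)
  change P.reflection i = P.coreflection i
  exact LinearEquiv.ext fun x => (coreflection_eq_reflection i x).symm

theorem affineWeylGroup_flip [IsEuclidean P] (b : P.Base) :
    affineWeylGroup b.flip = dualAffineWeylGroup b := by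
  ext g
  change g.linear ∈ weylGroup b.flip ∧ _ ↔ g.linear ∈ weylGroup b ∧ _
  rw [weylGroup_flip]
  rfl

theorem sub_mem_of_isAdmissible {W : Subgroup (V ≃ₗ[ℝ] V)} {L : AddSubgroup V} {ρ : V}
    (h : IsAdmissible W L ρ) {w : V ≃ₗ[ℝ] V} (hw : w ∈ W) : w ρ - ρ ∈ L := by
  obtain ⟨x, hx, hx'⟩ := h.subset ⟨w, hw, 0, L.zero_mem, rfl⟩
  rw [add_zero] at hx'
  rwa [hx', add_sub_cancel_left]

/-- Stability of `L` follows from admissibility alone: `w x = (w(ρ + x) - ρ) - (w ρ - ρ)`. -/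
theorem map_mem_of_isAdmissible {W : Subgroup (V ≃ₗ[ℝ] V)} {L : AddSubgroup V} {ρ : V}
    (h : IsAdmissible W L ρ) {w : V ≃ₗ[ℝ] V} (hw : w ∈ W) {x : V} (hx : x ∈ L) : w x ∈ L := by
  obtain ⟨y, hy, hy'⟩ := h.subset ⟨w, hw, x, hx, rfl⟩
  have h1 : w x = y - (w ρ - ρ) := by
    rw [map_add] at hy'
    rw [eq_sub_of_add_eq' hy']
    abel
  rw [h1]
  exact sub_mem hy (sub_mem_of_isAdmissible h hw)

section Main

variable [Finite ι] [IsEuclidean P] [P.IsRootSystem] [P.IsCrystallographic] [P.IsReduced]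
  [P.IsIrreducible] (b : P.Base) {ρ ρv : V}

/-- The dual lattice of `P` is `Q^∨` and that of `P^∨` is `Q`; each fact about weights is the
coweight fact for `P.flip`. -/
theorem isShiftedDuality (hρ : IsAdmissibleDualShift b ρ) (hρv : IsAdmissibleShift b ρv) :
    IsShiftedDuality (weylGroup b) (coweightLattice b) (P.corootSpan ℤ).toAddSubgroup
      (coweightLattice (P := P.flip) b.flip) (P.rootSpan ℤ).toAddSubgroup ρv ρ where
  inner_map := inner_weylGroup b
  stable₁ := weylGroup_corootSpan b
  stable₂ := weylGroup_rootSpan b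
  map_mem₁ _ hw _ hx := map_mem_of_isAdmissible hρv hw hx
  map_mem₂ _ hw _ hx := map_mem_of_isAdmissible hρ hw hx
  shift₁ _ hw := sub_mem_of_isAdmissible hρv hw
  shift₂ _ hw := sub_mem_of_isAdmissible hρ hw
  le₁ := corootSpan_le_coweightLattice b
  le₂ := corootSpan_le_coweightLattice (P := P.flip) b.flip
  integral₁ _ hx _ hq := inner_rootSpan_coweightLattice b hx hq
  integral₂ _ hx _ hq := inner_rootSpan_coweightLattice (P := P.flip) b.flip hx hq
  dual₁ v hv := mem_rootSpan_of_inner (P := P.flip) b.flip v hv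
  dual₂ v hv := mem_rootSpan_of_inner b v hv

theorem grid_eq_trivialPoints (hρ : IsAdmissibleDualShift b ρ) (hρv : IsAdmissibleShift b ρv)
    (σ : weylGroup b →* ℤˣ) (M : ℕ) :
    grid b σ M ρ ρv = trivialPoints _ (gammaHom (isShiftedDuality b hρ hρv) σ)
      (shiftedLattice M (coweightLattice b) ρv) (fundamentalDomain b) := by
  ext a
  constructor
  · rintro ⟨hX, hF, hγ⟩
    exact ⟨⟨hX, hF⟩, fun g hg => hγ g.1 g.2 hg⟩
  · rintro ⟨⟨hX, hF⟩, hγ⟩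
    exact ⟨hX, hF, fun g hg hga => hγ ⟨g, hg⟩ hga⟩

theorem labels_eq_image (hρ : IsAdmissibleDualShift b ρ) (hρv : IsAdmissibleShift b ρv)
    (σ : weylGroup b →* ℤˣ) {M : ℕ} (hM : 0 < M) :
    labels b σ M ρ ρv = (fun z : V => (M : ℝ) • z) ''
      trivialPoints _ (gammaHom (isShiftedDuality b hρ hρv).symm σ)
        (shiftedLattice M (coweightLattice (P := P.flip) b.flip) ρ)
        (fundamentalDomain (P := P.flip) b.flip) := by
  have hM' : (M : ℝ) ≠ 0 := by positivity
  ext c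
  constructor
  · rintro ⟨⟨x, hx, hc⟩, z, ⟨hF, hγ⟩, rfl⟩
    refine ⟨z, ⟨⟨⟨x, hx, ?_⟩, hF⟩, fun g hg => hγ g.1 g.2 hg⟩, rfl⟩
    rw [← hc, smul_smul, one_div_mul_cancel hM', one_smul]
  · rintro ⟨z, ⟨⟨⟨x, hx, rfl⟩, hF⟩, hγ⟩, rfl⟩
    refine ⟨⟨x, hx, ?_⟩, _, ⟨hF, fun g hg hga => hγ ⟨g, hg⟩ hga⟩, rfl⟩
    change (M : ℝ) • (1 / (M : ℝ)) • (ρ + x) = _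
    rw [smul_smul, mul_one_div_cancel hM', one_smul]

end Main

end Alcoves

end OrbitGrid

theorem mainTheorem2 {ι V : Type*} [Finite ι] [NormedAddCommGroup V] [InnerProductSpace ℝ V]
    (P : RootPairing ι ℝ V V) [OrbitGrid.IsEuclidean P] [P.IsRootSystem] [P.IsCrystallographic]
    [P.IsReduced] [P.IsIrreducible] (b : P.Base) (σ : OrbitGrid.weylGroup b →* ℤˣ) (ρ ρv : V)
    (hρ : OrbitGrid.IsAdmissibleDualShift b ρ) (hρv : OrbitGrid.IsAdmissibleShift b ρv)
    (M : ℕ) (hM : 0 < M) :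
    (OrbitGrid.labels b σ M ρ ρv).Finite ∧ (OrbitGrid.grid b σ M ρ ρv).Finite ∧
      (OrbitGrid.labels b σ M ρ ρv).ncard = (OrbitGrid.grid b σ M ρ ρv).ncard := by
  have h := OrbitGrid.isShiftedDuality b hρ hρv
  have := OrbitGrid.finite_weylGroup b
  have hM' : (M : ℝ) ≠ 0 := by positivity
  have hfin₁ := OrbitGrid.finite_shiftedLattice_inter_fundamentalDomain b hM ρv
  have hfin₂ := OrbitGrid.finite_shiftedLattice_inter_fundamentalDomain (P := P.flip) b.flip hM ρ
  have hF₂ := OrbitGrid.isStrictFundamentalDomain (P := P.flip) b.flip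
  rw [OrbitGrid.affineWeylGroup_flip] at hF₂
  rw [OrbitGrid.labels_eq_image b hρ hρv σ hM, OrbitGrid.grid_eq_trivialPoints b hρ hρv]
  refine ⟨(hfin₂.subset fun a ha => ha.1).image _, hfin₁.subset fun a ha => ha.1, ?_⟩
  rw [Set.ncard_image_of_injective _ (smul_right_injective V hM')]
  exact (OrbitGrid.ncard_trivialPoints_eq h σ hM (OrbitGrid.isStrictFundamentalDomain b) hF₂
    hfin₁ hfin₂).symm
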